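/- Let $Q\in\mathbb{R}^{n\times n}$ be symmetric positive semidefinite and let $A\in\mathbb{R}^{m\times n}$ have rows $a_1',\dots,a_m'$. For $(c,b)\in\mathbb{R}^n\times\mathbb{R}^m$ put $\mathcal F(b)=\{x\in\mathbb{R}^n: a_i'x\le b_i,\ i=1,\dots,m\}$ and $$\mathcal S(c,b)=\arg\min\{\tfrac12 x'Qx+c'x : x\in\mathcal F(b)\}.$$ Equip $\mathbb{R}^n$, as the space of the variable $x$, with an arbitrary norm $\|\cdot\|$, let $\|c\|_*=\max_{\|y\|\le 1}|c'y|$ be its dual norm, and equip $\mathbb{R}^n\times\mathbb{R}^m$ with the norm $\|(c,b)\|=\max\{\|c\|_*,\|b\|_\infty\}$. Let $d$ denote the corresponding distances, with $d(x,\emptyset)=+\infty$. Fix $(\bar c,\bar b)$ and $\bar x$, and assume that $\mathcal S(\bar c,\bar b)=\{\bar x\}$ and that the Slater constraint qualification holds at $\bar b$, i.e. some $y\in\mathbb{R}^n$ satisfies $a_i'y<\bar b_i$ for all $i$. The mapping $\mathcal S$ has the Aubin property at $((\bar c,\bar b),\bar x)$ if there are neighborhoods $U$ of $\bar x$ and $V$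 of $(\bar c,\bar b)$ and a constant $\kappa\ge 0$ such that $$d(x^2,\mathcal S(c^1,b^1))\le\kappa\, d((c^2,b^2),(c^1,b^1))\quad\text{whenever } (c^1,b^1),(c^2,b^2)\in V,\ x^2\in\mathcal S(c^2,b^2)\cap U;$$ the infimum of all such $\kappa$ (over all $U,V$) is the Lipschitz modulus $\mathrm{lip}\,\mathcal S((\bar c,\bar b),\bar x)$. Let $I_{\bar b}(\bar x)=\{i: a_i'\bar x=\bar b_i\}$, and let $\operatorname{cone}X$ be the convex cone generated by $X$, with $0\in\operatorname{cone}X$ always. Let $\mathcal M$ be the family of all sets $D\subset I_{\bar b}(\bar x)$ that are minimal with respect to inclusion among those satisfying $-(Q\bar x+\bar c)\in\operatorname{cone}\{a_i:i\in D\}$, and let $\mathcal L$ be the family of all $D\subset I_{\bar b}(\bar x)$ such that the family $(a_i)_{i\in D}$ is linearly independent and $-(Q\bar x+\bar c)\in\operatorname{cone}\{a_i:i\in D\}$ (in both cases $D=\emptyset$ is allowed). For $D\subset\{1,\dots,m\}$ let $A_D$ be the submatrix of $A$ formed by the rows with index in $D$, and let $$M_D=\begin{pmatrix}Q & A_D'\\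 A_D & 0\end{pmatrix},\qquad M_\emptyset=Q.$$ Then the following conditions are equivalent: (i) $\mathcal S$ has the Aubin property at $((\bar c,\bar b),\bar x)$; (ii) $M_D$ is nonsingular for all $D\in\mathcal M$; (iii) $M_D$ is nonsingular for all $D\in\mathcal L$. Moreover, under these equivalent conditions, $$\mathrm{lip}\,\mathcal S((\bar c,\bar b),\bar x)=\max_{D\in\mathcal L}\left\|\begin{pmatrix}I_n & 0_{n\times|D|}\end{pmatrix}M_D^{-1}\right\|,$$ where $\|B\|=\max\left\{\left\|B\binom{\alpha}{\beta}\right\| : \alpha\in\mathbb{R}^n,\ \beta\in\mathbb{R}^D,\ \max\{\|\alpha\|_*,\|\beta\|_\infty\}\le 1\right\}$. -/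

import Mathlib

open scoped Matrix Topology NNReal ENNReal

namespace ConvexQP

/-! ### Lipschitz behaviour of set-valued mappings -/

section SetValued

variable {X Y : Type*} [AddGroup X] [TopologicalSpace X] [AddGroup Y] [TopologicalSpace Y]

/-- The distance `inf {N (z - x) : x ∈ S}` from `z` to `S` for the norm `N`; it is `∞` for
empty `S`. -/
noncomputable def setDist (N : X → ℝ) (z : X) (S : Set X) : ℝ≥0∞ :=
  ⨅ x ∈ S, ENNReal.ofReal (N (z - x))

/-- `κ` is a Lipschitz constant of the set-valued mapping `G` around `(y, x)`, when the spaces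
carry the norms `P` (parameters) and `N` (values): for some neighbourhoods `U` of `x` and `V` of
`y`, `d(x₂, G y₁) ≤ κ d(y₂, y₁)` whenever `x₂ ∈ G y₂ ∩ U` and `y₁, y₂ ∈ V`. -/
def IsLipschitzConstAt (P : Y → ℝ) (N : X → ℝ) (G : Y → Set X) (y : Y) (x : X) (κ : ℝ≥0) :
    Prop :=
  ∃ U ∈ 𝓝 x, ∃ V ∈ 𝓝 y, ∀ y₁ ∈ V, ∀ y₂ ∈ V, ∀ x₂ ∈ G y₂ ∩ U,
    setDist N x₂ (G y₁) ≤ (κ : ℝ≥0∞) * ENNReal.ofReal (P (y₂ - y₁))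

/-- The Aubin property of `G` at the point `(y, x)` of its graph. -/
def HasAubinProperty (P : Y → ℝ) (N : X → ℝ) (G : Y → Set X) (y : Y) (x : X) : Prop :=
  x ∈ G y ∧ ∃ κ : ℝ≥0, IsLipschitzConstAt P N G y x κ

/-- The Lipschitz modulus: the infimum of all Lipschitz constants of `G` around `(y, x)`, which
is `∞` if there are none. -/
noncomputable def lipModulus (P : Y → ℝ) (N : X → ℝ) (G : Y → Set X) (y : Y) (x : X) : ℝ≥0∞ :=
  ⨅ (κ : ℝ≥0) (_ : IsLipschitzConstAt P N G y x κ), (κ : ℝ≥0∞)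

end SetValued

/-! ### Norms -/

/-- The dual norm `max {|c' y| : N y ≤ 1}` of the norm `N` on `ℝⁿ`. -/
noncomputable def dualNorm {n : ℕ} (N : Seminorm ℝ (Fin n → ℝ)) (c : Fin n → ℝ) : ℝ :=
  sSup {r : ℝ | ∃ y : Fin n → ℝ, N y ≤ 1 ∧ r = |c ⬝ᵥ y|}

/-- The norm `max {‖c‖_*, ‖b‖_∞}` on `ℝⁿ × ℝ^ι`. The norm of `ι → ℝ` is the maximum norm. -/
noncomputable def paramNorm {n : ℕ} {ι : Type*} [Fintype ι] (N : Seminorm ℝ (Fin n → ℝ))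
    (p : (Fin n → ℝ) × (ι → ℝ)) : ℝ :=
  max (dualNorm N p.1) ‖p.2‖

/-- The operator norm of an `n × (n + ι)` matrix, viewed as a linear map from `ℝⁿ × ℝ^ι` with the
norm `paramNorm N` to `ℝⁿ` with the norm `N`. -/
noncomputable def opNorm {n : ℕ} {ι : Type*} [Fintype ι] (N : Seminorm ℝ (Fin n → ℝ))
    (B : Matrix (Fin n) (Fin n ⊕ ι) ℝ) : ℝ :=
  sSup {r : ℝ | ∃ (α : Fin n → ℝ) (β : ι → ℝ), paramNorm N (α, β) ≤ 1 ∧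
    r = N (B *ᵥ Sum.elim α β)}

/-! ### The quadratic problem -/

section Problem

variable {n m : ℕ} (Q : Matrix (Fin n) (Fin n) ℝ) (A : Matrix (Fin m) (Fin n) ℝ)

/-- The feasible set `F(b) = {x : a_i' x ≤ b_i for all i}`; `a_i'` is the row `A i`. -/
def feasibleSet (b : Fin m → ℝ) : Set (Fin n → ℝ) :=
  {x | ∀ i, A i ⬝ᵥ x ≤ b i}

/-- The objective function `½ x' Q x + c' x`. -/
noncomputable def objective (c x : Fin n → ℝ) : ℝ :=
  1 / 2 * (x ⬝ᵥ (Q *ᵥ x)) + c ⬝ᵥ x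

/-- The argmin mapping `S(c, b)`. -/
def argminMap (p : (Fin n → ℝ) × (Fin m → ℝ)) : Set (Fin n → ℝ) :=
  {x | x ∈ feasibleSet A p.2 ∧ ∀ y ∈ feasibleSet A p.2, objective Q p.1 x ≤ objective Q p.1 y}

/-- The Slater constraint qualification at `b`. -/
def SlaterCQ (b : Fin m → ℝ) : Prop :=
  ∃ y : Fin n → ℝ, ∀ i, A i ⬝ᵥ y < b i

/-- The set of active indices at `x`. -/
def activeIndices (b : Fin m → ℝ) (x : Fin n → ℝ) : Set (Fin m) :=
  {i | A i ⬝ᵥ x = b i}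

/-- `D` is a set of active indices with `-(Q x + c) ∈ cone {a_i : i ∈ D}`. -/
def IsKKTSet (c : Fin n → ℝ) (b : Fin m → ℝ) (x : Fin n → ℝ) (D : Finset (Fin m)) : Prop :=
  (D : Set (Fin m)) ⊆ activeIndices A b x ∧
    -(Q *ᵥ x + c) ∈ PointedCone.hull ℝ ((fun i => A i) '' (D : Set (Fin m)))

/-- The family `𝓜` of the minimal KKT sets of indices. -/
def minimalKKTSets (c : Fin n → ℝ) (b : Fin m → ℝ) (x : Fin n → ℝ) : Set (Finset (Fin m)) :=
  {D | IsKKTSet Q A c b x D ∧ ∀ D' : Finset (Fin m), D' ⊂ D → ¬ IsKKTSet Q A c b x D'}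

/-- The extended family `𝓛`: the KKT sets of indices `D` for which the family `(a_i)_{i ∈ D}` is
linearly independent. -/
def extendedKKTSets (c : Fin n → ℝ) (b : Fin m → ℝ) (x : Fin n → ℝ) : Set (Finset (Fin m)) :=
  {D | IsKKTSet Q A c b x D ∧ LinearIndependent ℝ (fun i : D => A i)}

/-- The submatrix `A_D` of the rows of `A` with index in `D`. -/
def rowSubmatrix (D : Finset (Fin m)) : Matrix D (Fin n) ℝ :=
  A.submatrix (fun i : D => (i : Fin m)) id

/-- The KKT matrix `M_D`, with blocks `Q`, `A_D'`, `A_D`, `0`. -/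
def kktMatrix (D : Finset (Fin m)) : Matrix (Fin n ⊕ D) (Fin n ⊕ D) ℝ :=
  Matrix.fromBlocks Q (rowSubmatrix A D)ᵀ (rowSubmatrix A D) 0

/-- The matrix `(I_n 0) M_D⁻¹`. -/
noncomputable def solutionMatrix (D : Finset (Fin m)) : Matrix (Fin n) (Fin n ⊕ D) ℝ :=
  Matrix.fromCols (1 : Matrix (Fin n) (Fin n) ℝ) (0 : Matrix (Fin n) D ℝ) * (kktMatrix Q A D)⁻¹

end Problem

end ConvexQP

/-! Since `Q` is positive semidefinite, `M_D` is nonsingular exactly when the rows in `D` are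
independent and no nonzero `u` satisfies `Q u = 0` and `A_D u = 0` (`isUnit_kktMatrix_iff`). The
kernel condition is inherited by larger `D`, and every KKT set contains a minimal one, so testing it
on `𝓜` suffices for `𝓛`.

Necessity and the lower bound for the modulus rest on `IsKKTSet.exists_strict`: arbitrarily close to
the reference parameter there is one for which `x` is still a KKT point, exactly the constraints in
`D` are active, and all their multipliers are positive. A nonzero `u` in the common kernel would
then let a small tilt of the cost along `u` remove every solution near `x`. If `M_D` is nonsingular,
the solution near such a parameter is the affine function obtained by inverting `M_D`, so no
Lipschitz constant is smaller than the norm of its linear part.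

For sufficiency and the upper bound, Slater and uniqueness keep a solution near `x` under
perturbation. Its minimal KKT sets belong to `𝓛` because finitely generated cones are closed, and
nonsingularity with positive multipliers makes it unique. Hence the solution is a single-valued
selection of finitely many affine branches, and along a segment its increment is controlled by the
steepest branch (`seminorm_sub_le_of_closed_cover`). -/

namespace ConvexQP

open Set Filter

/-! ### Comparison of norms, dual norm and operator norm -/

section Norms

variable {n : ℕ} {ι : Type*} [Fintype ι] (N : Seminorm ℝ (Fin n → ℝ))

theorem continuous_seminorm : Continuous N := by
  rw [← continuousOn_univ]
  exact N.convexOn.continuousOn isOpen_univ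

theorem exists_seminorm_le : ∃ K : ℝ, 0 < K ∧ ∀ x, N x ≤ K * ‖x‖ := by
  obtain ⟨K, hK, h⟩ := N.bound_of_continuous_normedSpace (continuous_seminorm N)
  exact ⟨K, hK, h⟩

variable {N}

theorem exists_norm_le (hN : ∀ x, N x = 0 → x = 0) : ∃ K : ℝ, 0 < K ∧ ∀ x, ‖x‖ ≤ K * N x := by
  -- `δ` is the minimum of `N` on the unit sphere; for `n = 0` the sphere is empty and any positive
  -- value serves.
  obtain ⟨δ, hδ, h⟩ : ∃ δ : ℝ, 0 < δ ∧ ∀ x ∈ Metric.sphere (0 : Fin n → ℝ) 1, δ ≤ N x := by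
    rcases (Metric.sphere (0 : Fin n → ℝ) 1).eq_empty_or_nonempty with he | hne
    · exact ⟨1, one_pos, by simp [he]⟩
    · obtain ⟨x, hx, hmin⟩ := (isCompact_sphere (0 : Fin n → ℝ) 1).exists_isMinOn hne
        (continuous_seminorm N).continuousOn
      refine ⟨N x, lt_of_le_of_ne (apply_nonneg N x) fun h0 => ?_, fun y hy => hmin hy⟩
      simp [hN x h0.symm] at hx
  refine ⟨δ⁻¹, inv_pos.2 hδ, fun x => ?_⟩
  rcases eq_or_ne x 0 with rfl | hx
  · simp
  have hx' : 0 < ‖x‖ := norm_pos_iff.2 hx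
  have := h (‖x‖⁻¹ • x) (by simp [norm_smul, hx'.ne'])
  rw [map_smul_eq_mul, Real.norm_of_nonneg (inv_nonneg.2 hx'.le)] at this
  rw [inv_mul_eq_div, le_div_iff₀ hδ]
  calc ‖x‖ * δ ≤ ‖x‖ * (‖x‖⁻¹ * N x) := by gcongr
    _ = N x := by field_simp

theorem abs_dotProduct_le (c y : Fin n → ℝ) : |c ⬝ᵥ y| ≤ n * (‖c‖ * ‖y‖) := by
  rw [dotProduct]
  refine (Finset.abs_sum_le_sum_abs _ _).trans ?_
  refine (Finset.sum_le_card_nsmul _ _ (‖c‖ * ‖y‖) fun i _ => ?_).trans (by simp)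
  rw [abs_mul]
  gcongr
  · exact norm_le_pi_norm c i
  · exact norm_le_pi_norm y i

theorem dualNorm_bddAbove (hN : ∀ x, N x = 0 → x = 0) (c : Fin n → ℝ) :
    BddAbove {r : ℝ | ∃ y : Fin n → ℝ, N y ≤ 1 ∧ r = |c ⬝ᵥ y|} := by
  obtain ⟨K, hK, h⟩ := exists_norm_le hN
  refine ⟨n * (‖c‖ * (K * 1)), ?_⟩
  rintro r ⟨y, hy, rfl⟩
  refine (abs_dotProduct_le c y).trans ?_
  have := (h y).trans (mul_le_mul_of_nonneg_left hy hK.le)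
  gcongr

theorem dualNorm_nonneg (c : Fin n → ℝ) : 0 ≤ dualNorm N c :=
  Real.sSup_nonneg (by rintro r ⟨y, -, rfl⟩; exact abs_nonneg _)

theorem abs_dotProduct_le_dualNorm (hN : ∀ x, N x = 0 → x = 0) (c y : Fin n → ℝ) :
    |c ⬝ᵥ y| ≤ dualNorm N c * N y := by
  rcases eq_or_ne y 0 with rfl | hy
  · simp
  have hy' : 0 < N y := lt_of_le_of_ne (apply_nonneg N y) fun h => hy (hN y h.symm)
  have : |c ⬝ᵥ ((N y)⁻¹ • y)| ≤ dualNorm N c := by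
    refine le_csSup (dualNorm_bddAbove hN c) ⟨_, ?_, rfl⟩
    rw [map_smul_eq_mul, Real.norm_of_nonneg (inv_nonneg.2 hy'.le), inv_mul_cancel₀ hy'.ne']
  rw [dotProduct_smul, smul_eq_mul, abs_mul, abs_of_nonneg (inv_nonneg.2 hy'.le),
    inv_mul_eq_div, div_le_iff₀ hy'] at this
  exact this

/-- Test the functional `c` on the vector `c` itself: the maximum norm satisfies `‖c‖² ≤ c'c ≤ ‖c‖_*
N c`, and `N c` is at most a constant times `‖c‖`. -/
theorem exists_norm_le_dualNorm (hN : ∀ x, N x = 0 → x = 0) :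
    ∃ K : ℝ, 0 < K ∧ ∀ c, ‖c‖ ≤ K * dualNorm N c := by
  obtain ⟨K, hK, h⟩ := exists_seminorm_le N
  refine ⟨K, hK, fun c => ?_⟩
  rcases eq_or_ne c 0 with rfl | hc
  · simpa using mul_nonneg hK.le (dualNorm_nonneg _)
  have hsq : ‖c‖ * ‖c‖ ≤ c ⬝ᵥ c := by
    have : ‖c‖ ≤ √(c ⬝ᵥ c) := by
      refine (pi_norm_le_iff_of_nonneg (Real.sqrt_nonneg _)).2 fun i => ?_
      rw [Real.norm_eq_abs, ← Real.sqrt_mul_self_eq_abs]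
      exact Real.sqrt_le_sqrt (Finset.single_le_sum (f := fun i => c i * c i)
        (fun j _ => mul_self_nonneg _) (Finset.mem_univ i))
    calc ‖c‖ * ‖c‖ ≤ √(c ⬝ᵥ c) * √(c ⬝ᵥ c) := by gcongr
      _ = c ⬝ᵥ c := Real.mul_self_sqrt (Finset.sum_nonneg fun j _ => mul_self_nonneg _)
  have h1 := (le_abs_self _).trans (abs_dotProduct_le_dualNorm hN c c)
  have h2 := mul_le_mul_of_nonneg_left (h c) (dualNorm_nonneg (N := N) c)
  have hc' : 0 < ‖c‖ := norm_pos_iff.2 hc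
  refine le_of_mul_le_mul_right (hsq.trans (h1.trans (h2.trans (le_of_eq ?_)))) hc'
  ring

open scoped Pointwise in
theorem dualNorm_smul (t : ℝ) (c : Fin n → ℝ) : dualNorm N (t • c) = |t| * dualNorm N c := by
  have : {r : ℝ | ∃ y : Fin n → ℝ, N y ≤ 1 ∧ r = |(t • c) ⬝ᵥ y|} =
      |t| • {r : ℝ | ∃ y : Fin n → ℝ, N y ≤ 1 ∧ r = |c ⬝ᵥ y|} := by
    ext r
    simp only [mem_ofPred_eq, mem_smul_set, smul_dotProduct, smul_eq_mul, abs_mul]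
    constructor
    · rintro ⟨y, hy, rfl⟩
      exact ⟨_, ⟨y, hy, rfl⟩, rfl⟩
    · rintro ⟨_, ⟨y, hy, rfl⟩, rfl⟩
      exact ⟨y, hy, rfl⟩
  rw [dualNorm, this, Real.sSup_smul_of_nonneg (abs_nonneg t), smul_eq_mul, dualNorm]

theorem dualNorm_neg (c : Fin n → ℝ) : dualNorm N (-c) = dualNorm N c := by
  simpa using dualNorm_smul (N := N) (-1) c

theorem paramNorm_nonneg (p : (Fin n → ℝ) × (ι → ℝ)) : 0 ≤ paramNorm N p :=
  le_max_of_le_right (norm_nonneg _)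

theorem paramNorm_smul (t : ℝ) (p : (Fin n → ℝ) × (ι → ℝ)) :
    paramNorm N (t • p) = |t| * paramNorm N p := by
  simp only [paramNorm, Prod.smul_fst, Prod.smul_snd, dualNorm_smul, norm_smul, Real.norm_eq_abs]
  rw [mul_max_of_nonneg _ _ (abs_nonneg t)]

theorem exists_norm_le_paramNorm (hN : ∀ x, N x = 0 → x = 0) :
    ∃ K : ℝ, 0 < K ∧ ∀ p : (Fin n → ℝ) × (ι → ℝ), ‖p‖ ≤ K * paramNorm N p := by
  obtain ⟨K, hK, h⟩ := exists_norm_le_dualNorm hN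
  refine ⟨max K 1, by positivity, fun p => max_le ?_ ?_⟩
  · refine (h p.1).trans ?_
    gcongr
    exacts [dualNorm_nonneg _, le_max_left _ _, le_max_left _ _]
  · calc ‖p.2‖ ≤ 1 * paramNorm N p := by rw [one_mul]; exact le_max_right _ _
      _ ≤ _ := by gcongr; exacts [paramNorm_nonneg _, le_max_right _ _]

theorem opNorm_bddAbove (hN : ∀ x, N x = 0 → x = 0) (B : Matrix (Fin n) (Fin n ⊕ ι) ℝ) :
    BddAbove {r : ℝ | ∃ (α : Fin n → ℝ) (β : ι → ℝ), paramNorm N (α, β) ≤ 1 ∧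
      r = N (B *ᵥ Sum.elim α β)} := by
  obtain ⟨K, hK, h⟩ := exists_norm_le_paramNorm (ι := ι) hN
  have hcont : Continuous fun p : (Fin n → ℝ) × (ι → ℝ) => N (B *ᵥ Sum.elim p.1 p.2) := by
    refine (continuous_seminorm N).comp (Continuous.matrix_mulVec continuous_const ?_)
    refine continuous_pi fun i => ?_
    rcases i with i | i <;> simp <;> fun_prop
  refine ((isCompact_closedBall (0 : (Fin n → ℝ) × (ι → ℝ)) K).bddAbove_image
    hcont.continuousOn).mono ?_
  rintro r ⟨α, β, hp, rfl⟩
  refine ⟨(α, β), ?_, rfl⟩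
  rw [mem_closedBall_zero_iff]
  exact (h _).trans (by nlinarith)

theorem seminorm_mulVec_le (hN : ∀ x, N x = 0 → x = 0) (B : Matrix (Fin n) (Fin n ⊕ ι) ℝ)
    (α : Fin n → ℝ) (β : ι → ℝ) :
    N (B *ᵥ Sum.elim α β) ≤ opNorm N B * paramNorm N (α, β) := by
  obtain ⟨K, hK, h⟩ := exists_norm_le_paramNorm (ι := ι) hN
  rcases (paramNorm_nonneg (N := N) (α, β)).eq_or_lt with h0 | h0
  · have h1 := h (α, β)
    rw [← h0, mul_zero, norm_le_zero_iff, Prod.mk_eq_zero] at h1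
    have : Sum.elim α β = 0 := by
      ext i; rcases i with i | i <;> simp [h1.1, h1.2]
    simp [this, ← h0]
  · set t := paramNorm N (α, β) with ht
    have h1 : N (B *ᵥ Sum.elim (t⁻¹ • α) (t⁻¹ • β)) ≤ opNorm N B := by
      refine le_csSup (opNorm_bddAbove hN B) ⟨_, _, ?_, rfl⟩
      have := paramNorm_smul (N := N) t⁻¹ (α, β)
      rw [← ht, abs_of_pos (inv_pos.2 h0), inv_mul_cancel₀ h0.ne'] at this
      exact this.le
    have h2 : Sum.elim (t⁻¹ • α) (t⁻¹ • β) = t⁻¹ • Sum.elim α β := by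
      ext i; rcases i with i | i <;> simp
    rw [h2, Matrix.mulVec_smul, map_smul_eq_mul, Real.norm_of_nonneg (inv_nonneg.2 h0.le),
      inv_mul_eq_div, div_le_iff₀ h0] at h1
    exact h1

theorem opNorm_le {B : Matrix (Fin n) (Fin n ⊕ ι) ℝ} {κ : ℝ} (hκ : 0 ≤ κ)
    (h : ∀ (α : Fin n → ℝ) (β : ι → ℝ), N (B *ᵥ Sum.elim α β) ≤ κ * paramNorm N (α, β)) :
    opNorm N B ≤ κ := by
  refine Real.sSup_le ?_ hκ
  rintro r ⟨α, β, hp, rfl⟩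
  exact (h α β).trans (mul_le_of_le_one_right hκ hp)

end Norms

/-! ### Finitely generated cones: Carathéodory reduction, closedness, Farkas -/

section Cones

variable {ι E : Type*} [AddCommGroup E] [Module ℝ E]

theorem mem_hull_image_finset {v : ι → E} {D : Finset ι} {y : E} :
    y ∈ PointedCone.hull ℝ (v '' (D : Set ι)) ↔
      ∃ l : ι → ℝ, (∀ i ∈ D, 0 ≤ l i) ∧ ∑ i ∈ D, l i • v i = y := by
  rw [Submodule.mem_span_image_finset_iff_exists_fun']
  constructor
  · rintro ⟨l, rfl⟩
    exact ⟨fun i => l i, fun i _ => (l i).2, rfl⟩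
  · rintro ⟨l, hl, rfl⟩
    -- Coefficients over the nonnegative reals must be nonnegative for every index, whereas `l` is
    -- so only on `D`.
    refine ⟨fun i => ⟨max (l i) 0, le_max_right _ _⟩, Finset.sum_congr rfl fun i hi => ?_⟩
    change max (l i) 0 • v i = _
    rw [max_eq_left (hl i hi)]

theorem pos_of_minimal_mem_hull [DecidableEq ι] {v : ι → E} {D : Finset ι} {y : E}
    (hmin : ∀ D' ⊂ D, y ∉ PointedCone.hull ℝ (v '' (D' : Set ι)))
    {l : ι → ℝ} (hl : ∀ i ∈ D, 0 ≤ l i) (hy : ∑ i ∈ D, l i • v i = y) :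
    ∀ i ∈ D, 0 < l i := by
  intro i hi
  refine lt_of_le_of_ne (hl i hi) fun h0 => hmin (D.erase i) (Finset.erase_ssubset hi) ?_
  refine mem_hull_image_finset.2 ⟨l, fun j hj => hl j (Finset.mem_of_mem_erase hj), ?_⟩
  rw [← hy, ← Finset.add_sum_erase D _ hi, ← h0, zero_smul, zero_add]

/-- Carathéodory's argument: move the multipliers along a linear relation until the first one
vanishes. The result still represents `y`, against the positivity forced by minimality. -/
theorem linearIndependent_of_minimal_mem_hull [DecidableEq ι] {v : ι → E} {D : Finset ι} {y : E}
    (hD : y ∈ PointedCone.hull ℝ (v '' (D : Set ι)))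
    (hmin : ∀ D' ⊂ D, y ∉ PointedCone.hull ℝ (v '' (D' : Set ι))) :
    LinearIndependent ℝ (fun i : D => v i) := by
  obtain ⟨l, hl, hy⟩ := mem_hull_image_finset.1 hD
  have hpos := pos_of_minimal_mem_hull hmin hl hy
  refine linearIndepOn_finset_iff.2 ?_
  -- It is enough to exclude positive coefficients, since `-g` is a relation whenever `g` is.
  suffices H : ∀ g : ι → ℝ, ∑ i ∈ D, g i • v i = 0 → ∀ i ∈ D, ¬ 0 < g i by
    intro g hg i hi
    refine le_antisymm (not_lt.1 (H g hg i hi)) (not_lt.1 fun h => H (-g) ?_ i hi (by simpa using h))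
    simp [hg]
  intro g hg i₀ hi₀ hpos₀
  -- The least ratio `l k / g k` is the longest step along `-g` that keeps all multipliers
  -- nonnegative; the multiplier of `k` becomes zero.
  obtain ⟨k, hk, hkmin⟩ := (D.filter fun i => 0 < g i).exists_min_image (fun i => l i / g i)
    ⟨i₀, by simp [hi₀, hpos₀]⟩
  rw [Finset.mem_filter] at hk
  have hl' : ∀ i ∈ D, 0 ≤ l i - l k / g k * g i := by
    intro i hi
    rcases lt_or_ge 0 (g i) with h | h
    · have := hkmin i (by simp [hi, h])
      rw [le_div_iff₀ h] at this
      linarith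
    · have : 0 < l k / g k := div_pos (hpos k hk.1) hk.2
      nlinarith [hl i hi]
  have hy' : ∑ i ∈ D, (l i - l k / g k * g i) • v i = y := by
    simp only [sub_smul, mul_smul, Finset.sum_sub_distrib, ← Finset.smul_sum, hg, hy]
    simp
  have := pos_of_minimal_mem_hull hmin hl' hy' k hk.1
  rw [div_mul_cancel₀ _ hk.2.ne', sub_self] at this
  exact lt_irrefl _ this

theorem exists_minimal_mem_hull {v : ι → E} {D : Finset ι} {y : E}
    (hD : y ∈ PointedCone.hull ℝ (v '' (D : Set ι))) :
    ∃ D' ⊆ D, y ∈ PointedCone.hull ℝ (v '' (D' : Set ι)) ∧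
      ∀ D'' ⊂ D', y ∉ PointedCone.hull ℝ (v '' (D'' : Set ι)) := by
  induction D using Finset.strongInduction with
  | H D ih =>
    by_cases h : ∀ D'' ⊂ D, y ∉ PointedCone.hull ℝ (v '' (D'' : Set ι))
    · exact ⟨D, subset_rfl, hD, h⟩
    · push Not at h
      obtain ⟨D₁, h1, h2⟩ := h
      obtain ⟨D', h3, h4⟩ := ih D₁ h1 h2
      exact ⟨D', h3.trans h1.1, h4⟩

variable [TopologicalSpace E] [IsTopologicalAddGroup E] [ContinuousSMul ℝ E] [T2Space E]

/-- The cone is the image of the closed orthant under an injective linear map from a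
finite-dimensional space, which is a closed embedding. -/
theorem isClosed_hull_of_linearIndependent {v : ι → E} {D : Finset ι}
    (hD : LinearIndependent ℝ (fun i : D => v i)) :
    IsClosed (PointedCone.hull ℝ (v '' (D : Set ι)) : Set E) := by
  have hinj : LinearMap.ker (Fintype.linearCombination ℝ (fun i : D => v i)) = ⊥ :=
    LinearMap.ker_eq_bot.2 (linearIndependent_iff_injective_fintypeLinearCombination.1 hD)
  have hcl := LinearMap.isClosedEmbedding_of_injective hinj
  have : (PointedCone.hull ℝ (v '' (D : Set ι)) : Set E) =
      Fintype.linearCombination ℝ (fun i : D => v i) '' {l | ∀ i, 0 ≤ l i} := by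
    classical
    ext y
    rw [SetLike.mem_coe, mem_hull_image_finset]
    constructor
    · rintro ⟨l, hl, rfl⟩
      refine ⟨fun i => l i, fun i => hl i i.2, ?_⟩
      rw [Fintype.linearCombination_apply, ← Finset.sum_coe_sort (s := D)]
    · rintro ⟨l, hl, rfl⟩
      refine ⟨fun i => if h : i ∈ D then l ⟨i, h⟩ else 0, fun i hi => by simp [hi, hl ⟨i, hi⟩], ?_⟩
      rw [Fintype.linearCombination_apply, ← Finset.sum_coe_sort (s := D)]
      simp
  rw [this]
  refine hcl.isClosedMap _ ?_
  simp only [ofPred_forall]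
  exact isClosed_iInter fun i => isClosed_le continuous_const (continuous_apply i)

/-- By Carathéodory the cone is a finite union of cones with linearly independent generators. -/
theorem isClosed_hull_image_finset (v : ι → E) (D : Finset ι) :
    IsClosed (PointedCone.hull ℝ (v '' (D : Set ι)) : Set E) := by
  classical
  have : (PointedCone.hull ℝ (v '' (D : Set ι)) : Set E) =
      ⋃ D' ∈ {D' : Finset ι | D' ⊆ D ∧ LinearIndependent ℝ (fun i : D' => v i)},
        (PointedCone.hull ℝ (v '' (D' : Set ι)) : Set E) := by
    apply subset_antisymm
    · intro y hy
      obtain ⟨D', h1, h2, h3⟩ := exists_minimal_mem_hull hy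
      simp only [mem_iUnion]
      refine ⟨D', ?_, h2⟩
      simp only [mem_ofPred_eq]
      exact ⟨h1, linearIndependent_of_minimal_mem_hull h2 h3⟩
    · refine iUnion₂_subset fun D' h => ?_
      simp only [mem_ofPred_eq] at h
      exact Submodule.span_mono (image_mono (by exact_mod_cast h.1))
  rw [this]
  refine Set.Finite.isClosed_biUnion ?_ fun D' h => isClosed_hull_of_linearIndependent h.2
  exact D.powerset.finite_toSet.subset fun D' h => by simpa using h.1

end Cones

/-- **Farkas' lemma** -/
theorem exists_dotProduct_pos_of_notMem_hull {n : ℕ} {ι : Type*} {v : ι → Fin n → ℝ}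
    {D : Finset ι} {y : Fin n → ℝ} (hy : y ∉ PointedCone.hull ℝ (v '' (D : Set ι))) :
    ∃ d : Fin n → ℝ, (∀ i ∈ D, v i ⬝ᵥ d ≤ 0) ∧ 0 < y ⬝ᵥ d := by
  set C := PointedCone.hull ℝ (v '' (D : Set ι)) with hC
  obtain ⟨f, u, h1, h2⟩ := geometric_hahn_banach_closed_point C.convex
    (isClosed_hull_image_finset v D) hy
  have hf : ∀ z, f z = z ⬝ᵥ fun i => f (Pi.single i 1) := by
    intro z
    conv_lhs => rw [← Finset.univ_sum_single z, map_sum]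
    refine Finset.sum_congr rfl fun i _ => ?_
    rw [← smul_eq_mul, ← map_smul, ← Pi.single_smul, smul_eq_mul, mul_one]
  have h0 : 0 < u := by simpa using h1 0 C.zero_mem
  refine ⟨fun i => f (Pi.single i 1), fun i hi => ?_, ?_⟩
  · rw [← hf]
    by_contra! hpos
    have hmem : v i ∈ C := PointedCone.subset_hull ⟨i, hi, rfl⟩
    -- If `f` were positive at a generator, a multiple of it would be a point of the cone where `f`
    -- equals the separating level `u`.
    have := h1 ((u / f (v i)) • v i) (PointedCone.smul_mem C (div_pos h0 hpos).le hmem)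
    rw [map_smul, smul_eq_mul, div_mul_cancel₀ _ hpos.ne'] at this
    exact lt_irrefl _ this
  · rw [← hf]
    exact h0.trans h2

/-! ### Optimality conditions and the linear KKT system -/

section KKT

variable {n m : ℕ} {Q : Matrix (Fin n) (Fin n) ℝ} {A : Matrix (Fin m) (Fin n) ℝ}

/-- `x` and the multipliers `l i`, `i ∈ D`, satisfy the Karush-Kuhn-Tucker conditions. -/
structure IsKKTPoint (Q : Matrix (Fin n) (Fin n) ℝ) (A : Matrix (Fin m) (Fin n) ℝ)
    (p : (Fin n → ℝ) × (Fin m → ℝ)) (D : Finset (Fin m)) (x : Fin n → ℝ) (l : Fin m → ℝ) :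
    Prop where
  feasible : x ∈ feasibleSet A p.2
  active : ∀ i ∈ D, A i ⬝ᵥ x = p.2 i
  nonneg : ∀ i ∈ D, 0 ≤ l i
  stationary : Q *ᵥ x + p.1 + ∑ i ∈ D, l i • A i = 0

theorem objective_add (hQ : Q.PosSemidef) (c x u : Fin n → ℝ) :
    objective Q c (x + u) = objective Q c x + (Q *ᵥ x + c) ⬝ᵥ u + 1 / 2 * (u ⬝ᵥ Q *ᵥ u) := by
  have hsymm : Qᵀ = Q := by simpa using hQ.isHermitian.eq
  have h : x ⬝ᵥ Q *ᵥ u = u ⬝ᵥ Q *ᵥ x := by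
    rw [Matrix.dotProduct_mulVec, ← Matrix.mulVec_transpose, hsymm, dotProduct_comm]
  simp only [objective, Matrix.mulVec_add, add_dotProduct, dotProduct_add, h,
    dotProduct_comm (Q *ᵥ x) u]
  ring

theorem objective_eq (hQ : Q.PosSemidef) (c x y : Fin n → ℝ) :
    objective Q c y = objective Q c x + (Q *ᵥ x + c) ⬝ᵥ (y - x) +
      1 / 2 * ((y - x) ⬝ᵥ Q *ᵥ (y - x)) := by
  rw [← objective_add hQ, add_sub_cancel]

theorem quadratic_nonneg (hQ : Q.PosSemidef) (u : Fin n → ℝ) : 0 ≤ u ⬝ᵥ Q *ᵥ u := by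
  simpa using hQ.dotProduct_mulVec_nonneg u

theorem mulVec_eq_zero_of_quadratic (hQ : Q.PosSemidef) {u : Fin n → ℝ}
    (h : u ⬝ᵥ Q *ᵥ u = 0) : Q *ᵥ u = 0 :=
  (hQ.dotProduct_mulVec_zero_iff u).1 (by simpa using h)

theorem isKKTSet_iff {c : Fin n → ℝ} {b : Fin m → ℝ} {x : Fin n → ℝ} {D : Finset (Fin m)} :
    IsKKTSet Q A c b x D ↔ (∀ i ∈ D, A i ⬝ᵥ x = b i) ∧
      ∃ l : Fin m → ℝ, (∀ i ∈ D, 0 ≤ l i) ∧ Q *ᵥ x + c + ∑ i ∈ D, l i • A i = 0 := by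
  rw [IsKKTSet, mem_hull_image_finset]
  refine and_congr Iff.rfl (exists_congr fun l => and_congr Iff.rfl ?_)
  rw [eq_neg_iff_add_eq_zero, add_comm]

namespace IsKKTPoint

variable {p : (Fin n → ℝ) × (Fin m → ℝ)} {D : Finset (Fin m)} {x : Fin n → ℝ} {l : Fin m → ℝ}

theorem isKKTSet (h : IsKKTPoint Q A p D x l) : IsKKTSet Q A p.1 p.2 x D :=
  isKKTSet_iff.2 ⟨h.active, l, h.nonneg, h.stationary⟩

theorem gradient_dotProduct (h : IsKKTPoint Q A p D x l) (u : Fin n → ℝ) :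
    (Q *ᵥ x + p.1) ⬝ᵥ u = - ∑ i ∈ D, l i * (A i ⬝ᵥ u) := by
  rw [eq_neg_of_add_eq_zero_left h.stationary, neg_dotProduct, sum_dotProduct]
  simp

/-- Complementarity turns the exact quadratic expansion into a sum that is termwise nonnegative for
feasible `y`. Optimality of `x` follows at once, and uniqueness comes from the case of equality. -/
theorem objective_eq_add (h : IsKKTPoint Q A p D x l) (hQ : Q.PosSemidef) (y : Fin n → ℝ) :
    objective Q p.1 y = objective Q p.1 x + ∑ i ∈ D, l i * (p.2 i - A i ⬝ᵥ y) +
      1 / 2 * ((y - x) ⬝ᵥ Q *ᵥ (y - x)) := by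
  rw [objective_eq hQ p.1 x y, h.gradient_dotProduct, ← Finset.sum_neg_distrib]
  congr 2
  refine Finset.sum_congr rfl fun i hi => ?_
  rw [dotProduct_sub, h.active i hi]
  ring

theorem mem_argminMap (h : IsKKTPoint Q A p D x l) (hQ : Q.PosSemidef) :
    x ∈ argminMap Q A p := by
  refine ⟨h.feasible, fun y hy => ?_⟩
  have h1 : 0 ≤ ∑ i ∈ D, l i * (p.2 i - A i ⬝ᵥ y) :=
    Finset.sum_nonneg fun i hi => mul_nonneg (h.nonneg i hi) (sub_nonneg.2 (hy i))
  have h2 := quadratic_nonneg hQ (y - x)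
  rw [h.objective_eq_add hQ y]
  linarith

/-- A second minimizer annihilates every nonnegative term in `objective_eq_add`. As the multipliers
are positive, all constraints in `D` are active at `y`, and `Q (y - x) = 0`; the kernel condition
then applies to `y - x`. -/
theorem eq_of_mem_argminMap (h : IsKKTPoint Q A p D x l) (hQ : Q.PosSemidef)
    (hl : ∀ i ∈ D, 0 < l i)
    (hker : ∀ u : Fin n → ℝ, Q *ᵥ u = 0 → (∀ i ∈ D, A i ⬝ᵥ u = 0) → u = 0)
    {y : Fin n → ℝ} (hy : y ∈ argminMap Q A p) : y = x := by
  have h1 : ∀ i ∈ D, 0 ≤ l i * (p.2 i - A i ⬝ᵥ y) := fun i hi =>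
    mul_nonneg (h.nonneg i hi) (sub_nonneg.2 (hy.1 i))
  have h2 := quadratic_nonneg hQ (y - x)
  have h3 := hy.2 x h.feasible
  rw [h.objective_eq_add hQ y] at h3
  have h4 := Finset.sum_nonneg h1
  rw [← sub_eq_zero]
  refine hker _ (mulVec_eq_zero_of_quadratic hQ (by linarith)) fun i hi => ?_
  have h5 := (Finset.sum_eq_zero_iff_of_nonneg h1).1 (by linarith) i hi
  rcases mul_eq_zero.1 h5 with h6 | h6
  · exact absurd h6 (hl i hi).ne'
  · rw [dotProduct_sub, h.active i hi]
    linarith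

end IsKKTPoint

open Classical in
-- Otherwise Farkas gives a descent direction along which no active constraint increases. Because
-- the constraints are affine, short steps along it stay feasible without any constraint
-- qualification.
theorem isKKTSet_activeIndices (hQ : Q.PosSemidef) {p : (Fin n → ℝ) × (Fin m → ℝ)}
    {x : Fin n → ℝ} (hx : x ∈ argminMap Q A p) :
    IsKKTSet Q A p.1 p.2 x (activeIndices A p.2 x).toFinset := by
  refine ⟨by simp, ?_⟩
  by_contra hnot
  obtain ⟨d, h1, h2⟩ := exists_dotProduct_pos_of_notMem_hull hnot
  have hfeas : ∀ᶠ t : ℝ in 𝓝[>] 0, x + t • d ∈ feasibleSet A p.2 := by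
    simp only [feasibleSet, mem_ofPred_eq]
    rw [eventually_all]
    intro i
    by_cases hi : A i ⬝ᵥ x = p.2 i
    · filter_upwards [self_mem_nhdsWithin] with t ht
      have := h1 i (Set.mem_toFinset.2 hi)
      rw [dotProduct_add, dotProduct_smul, hi, smul_eq_mul]
      nlinarith [mem_Ioi.1 ht]
    · have hlt : A i ⬝ᵥ (x + (0 : ℝ) • d) < p.2 i := by
        simpa using lt_of_le_of_ne (hx.1 i) hi
      have hc : Continuous fun t : ℝ => A i ⬝ᵥ (x + t • d) := by fun_prop
      filter_upwards [nhdsWithin_le_nhds (hc.continuousAt.eventually_lt_const hlt)] with t ht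
      exact ht.le
  have hdec : ∀ᶠ t : ℝ in 𝓝[>] 0, (Q *ᵥ x + p.1) ⬝ᵥ d + 1 / 2 * t * (d ⬝ᵥ Q *ᵥ d) < 0 := by
    have hc : Continuous fun t : ℝ => (Q *ᵥ x + p.1) ⬝ᵥ d + 1 / 2 * t * (d ⬝ᵥ Q *ᵥ d) := by
      fun_prop
    refine nhdsWithin_le_nhds (hc.continuousAt.eventually_lt_const ?_)
    rw [neg_dotProduct, neg_pos] at h2
    change _ + 1 / 2 * 0 * _ < 0
    rwa [mul_zero, zero_mul, add_zero]
  obtain ⟨t, ht1, ht2, ht3⟩ := (hfeas.and (hdec.and self_mem_nhdsWithin)).exists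
  have := hx.2 _ ht1
  rw [objective_add hQ, Matrix.mulVec_smul] at this
  simp only [dotProduct_smul, smul_dotProduct, smul_eq_mul] at this
  nlinarith [mul_neg_of_pos_of_neg (mem_Ioi.1 ht3) ht2]

theorem IsKKTSet.exists_minimal {c : Fin n → ℝ} {b : Fin m → ℝ} {x : Fin n → ℝ}
    {D : Finset (Fin m)} (h : IsKKTSet Q A c b x D) :
    ∃ D' ⊆ D, D' ∈ minimalKKTSets Q A c b x := by
  obtain ⟨D', h1, h2, h3⟩ := exists_minimal_mem_hull h.2
  have : (D' : Set (Fin m)) ⊆ D := by exact_mod_cast h1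
  exact ⟨D', h1, ⟨this.trans h.1, h2⟩, fun D'' h4 h5 => h3 D'' h4 h5.2⟩

theorem linearIndependent_of_mem_minimalKKTSets {c : Fin n → ℝ} {b : Fin m → ℝ}
    {x : Fin n → ℝ} {D : Finset (Fin m)} (h : D ∈ minimalKKTSets Q A c b x) :
    LinearIndependent ℝ (fun i : D => A i) := by
  refine linearIndependent_of_minimal_mem_hull h.1.2 fun D' h1 h2 => h.2 D' h1 ⟨?_, h2⟩
  have : (D' : Set (Fin m)) ⊆ D := by exact_mod_cast h1.1
  exact this.trans h.1.1

theorem minimalKKTSets_subset_extendedKKTSets {c : Fin n → ℝ} {b : Fin m → ℝ} {x : Fin n → ℝ} :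
    minimalKKTSets Q A c b x ⊆ extendedKKTSets Q A c b x :=
  fun _ h => ⟨h.1, linearIndependent_of_mem_minimalKKTSets h⟩

theorem exists_isKKTPoint_pos (hQ : Q.PosSemidef) {p : (Fin n → ℝ) × (Fin m → ℝ)}
    {x : Fin n → ℝ} (hx : x ∈ argminMap Q A p) :
    ∃ (D : Finset (Fin m)) (l : Fin m → ℝ), D ∈ extendedKKTSets Q A p.1 p.2 x ∧
      IsKKTPoint Q A p D x l ∧ ∀ i ∈ D, 0 < l i := by
  obtain ⟨D, -, hD⟩ := (isKKTSet_activeIndices hQ hx).exists_minimal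
  obtain ⟨h1, l, h2, h3⟩ := isKKTSet_iff.1 hD.1
  refine ⟨D, l, minimalKKTSets_subset_extendedKKTSets hD, ⟨hx.1, h1, h2, h3⟩, ?_⟩
  refine pos_of_minimal_mem_hull (v := fun i => A i) (y := -(Q *ᵥ x + p.1)) ?_ h2 ?_
  · intro D' h4 h5
    have : (D' : Set (Fin m)) ⊆ D := by exact_mod_cast h4.1
    exact hD.2 D' h4 ⟨this.trans hD.1.1, h5⟩
  · rw [eq_neg_iff_add_eq_zero, add_comm, h3]

theorem kktMatrix_mulVec (D : Finset (Fin m)) (u : Fin n → ℝ) (l : D → ℝ) :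
    kktMatrix Q A D *ᵥ Sum.elim u l =
      Sum.elim (Q *ᵥ u + ∑ i : D, l i • A i) (fun i : D => A i ⬝ᵥ u) := by
  rw [kktMatrix, Matrix.fromBlocks_mulVec]
  congr 1
  · congr 1
    ext j
    simp [Matrix.mulVec, dotProduct, rowSubmatrix, mul_comm]
  · simp only [Sum.elim_comp_inl, Sum.elim_comp_inr, Matrix.zero_mulVec, add_zero]
    rfl

/-- For a kernel vector `(u, l)`, pairing the first block with `u` eliminates `l` because `A_D u =
0`. This leaves `u' Q u = 0`, hence `Q u = 0` by semidefiniteness. -/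
theorem isUnit_kktMatrix_iff (hQ : Q.PosSemidef) {D : Finset (Fin m)} :
    IsUnit (kktMatrix Q A D) ↔ LinearIndependent ℝ (fun i : D => A i) ∧
      ∀ u : Fin n → ℝ, Q *ᵥ u = 0 → (∀ i ∈ D, A i ⬝ᵥ u = 0) → u = 0 := by
  rw [← Matrix.mulVec_injective_iff_isUnit]
  change Function.Injective (kktMatrix Q A D).mulVecLin ↔ _
  rw [injective_iff_map_eq_zero]
  simp only [Matrix.mulVecLin_apply]
  constructor
  · intro h
    constructor
    · rw [Fintype.linearIndependent_iff]
      intro l hl i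
      have := h (Sum.elim 0 l) (by
        rw [kktMatrix_mulVec, hl]
        ext (j | j) <;> simp)
      exact congrFun this (Sum.inr i)
    · intro u h1 h2
      have := h (Sum.elim u 0) (by
        rw [kktMatrix_mulVec, h1]
        ext (j | j)
        · simp
        · simpa using h2 j j.2)
      ext j
      exact congrFun this (Sum.inl j)
  · rintro ⟨hli, hker⟩ z hz
    obtain ⟨u, l, rfl⟩ : ∃ (u : Fin n → ℝ) (l : D → ℝ), z = Sum.elim u l :=
      ⟨_, _, (Sum.elim_comp_inl_inr z).symm⟩
    rw [kktMatrix_mulVec] at hz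
    have h1 : Q *ᵥ u + ∑ i : D, l i • A i = 0 := by
      ext j; exact congrFun hz (Sum.inl j)
    have h2 : ∀ i : D, A i ⬝ᵥ u = 0 := fun i => congrFun hz (Sum.inr i)
    have h3 : Q *ᵥ u = 0 := by
      refine mulVec_eq_zero_of_quadratic hQ ?_
      have := congrArg (fun w => w ⬝ᵥ u) h1
      simpa [add_dotProduct, sum_dotProduct, h2, dotProduct_comm (Q *ᵥ u)] using this
    have h4 : u = 0 := hker u h3 fun i hi => h2 ⟨i, hi⟩
    rw [h3, zero_add] at h1
    have h5 := Fintype.linearIndependent_iff.1 hli l h1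
    ext (j | j)
    · simp [h4]
    · simp [h5]

/-- The solution of the linear system with matrix `kktMatrix Q A D` that the parameter `p`
defines. -/
noncomputable def kktSolution (Q : Matrix (Fin n) (Fin n) ℝ) (A : Matrix (Fin m) (Fin n) ℝ)
    (D : Finset (Fin m)) (p : (Fin n → ℝ) × (Fin m → ℝ)) : Fin n ⊕ D → ℝ :=
  (kktMatrix Q A D)⁻¹ *ᵥ Sum.elim (-p.1) (fun i : D => p.2 i)

theorem solutionMatrix_mulVec (D : Finset (Fin m)) (z : Fin n ⊕ D → ℝ) :
    solutionMatrix Q A D *ᵥ z = ((kktMatrix Q A D)⁻¹ *ᵥ z) ∘ Sum.inl := by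
  rw [solutionMatrix, ← Matrix.mulVec_mulVec, Matrix.fromCols_mulVec]
  simp

theorem kktSolution_sub (D : Finset (Fin m)) (p q : (Fin n → ℝ) × (Fin m → ℝ)) :
    kktSolution Q A D p - kktSolution Q A D q = kktSolution Q A D (p - q) := by
  rw [kktSolution, kktSolution, ← Matrix.mulVec_sub, kktSolution]
  congr 1
  ext (i | i) <;> simp [add_comm, sub_eq_add_neg]

theorem continuous_kktSolution (D : Finset (Fin m)) : Continuous (kktSolution Q A D) := by
  refine Continuous.matrix_mulVec continuous_const (continuous_pi fun i => ?_)
  rcases i with i | i <;> simp <;> fun_prop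

theorem IsKKTPoint.eq_kktSolution {p : (Fin n → ℝ) × (Fin m → ℝ)} {D : Finset (Fin m)}
    {x : Fin n → ℝ} {l : Fin m → ℝ} (h : IsKKTPoint Q A p D x l)
    (hD : IsUnit (kktMatrix Q A D)) :
    kktSolution Q A D p = Sum.elim x (fun i : D => l i) := by
  have hdet := (Matrix.isUnit_iff_isUnit_det _).1 hD
  rw [kktSolution, ← Matrix.one_mulVec (Sum.elim x (fun i : D => l i)),
    ← Matrix.nonsing_inv_mul _ hdet, ← Matrix.mulVec_mulVec, kktMatrix_mulVec]
  congr 2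
  · have := h.stationary
    rw [← Finset.sum_coe_sort] at this
    rw [neg_eq_iff_add_eq_zero, ← this]
    abel
  · ext i
    exact (h.active i i.2).symm

theorem isKKTPoint_kktSolution {p : (Fin n → ℝ) × (Fin m → ℝ)} {D : Finset (Fin m)}
    (hD : IsUnit (kktMatrix Q A D)) (hx : kktSolution Q A D p ∘ Sum.inl ∈ feasibleSet A p.2)
    {l : Fin m → ℝ} (hl : ∀ i : D, l i = kktSolution Q A D p (Sum.inr i))
    (hnonneg : ∀ i ∈ D, 0 ≤ l i) :
    IsKKTPoint Q A p D (kktSolution Q A D p ∘ Sum.inl) l := by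
  have hdet := (Matrix.isUnit_iff_isUnit_det _).1 hD
  have h : kktMatrix Q A D *ᵥ Sum.elim (kktSolution Q A D p ∘ Sum.inl)
      (kktSolution Q A D p ∘ Sum.inr) = Sum.elim (-p.1) (fun i : D => p.2 i) := by
    rw [Sum.elim_comp_inl_inr, kktSolution, Matrix.mulVec_mulVec, Matrix.mul_nonsing_inv _ hdet,
      Matrix.one_mulVec]
  rw [kktMatrix_mulVec, Sum.elim_eq_iff] at h
  refine ⟨hx, fun i hi => congrFun h.2 ⟨i, hi⟩, hnonneg, ?_⟩
  rw [← Finset.sum_coe_sort, add_right_comm]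
  simp only [hl]
  exact (eq_neg_iff_add_eq_zero).1 h.1

/-- This removes degeneracy: at the new parameter the active set is exactly `D`, with strict
complementarity, so small further perturbations do not change the set of relevant constraints. -/
theorem IsKKTSet.exists_strict {c : Fin n → ℝ} {b : Fin m → ℝ} {x : Fin n → ℝ}
    {D : Finset (Fin m)} (h : IsKKTSet Q A c b x D) (hx : x ∈ feasibleSet A b)
    {V : Set ((Fin n → ℝ) × (Fin m → ℝ))} (hV : V ∈ 𝓝 (c, b)) :
    ∃ q ∈ V, ∃ l, IsKKTPoint Q A q D x l ∧ (∀ i ∈ D, 0 < l i) ∧ ∀ i ∉ D, A i ⬝ᵥ x < q.2 i := by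
  classical
  obtain ⟨h1, l, h2, h3⟩ := isKKTSet_iff.1 h
  -- Subtracting `ε ∑ a_i` from the cost raises every multiplier in `D` by `ε`; relaxing the bounds
  -- outside `D` by `ε` makes those constraints slack. The point `x` stays fixed.
  set f : ℝ → (Fin n → ℝ) × (Fin m → ℝ) := fun ε =>
    (c - ε • ∑ i ∈ D, A i, b + ε • fun i => if i ∈ D then 0 else 1) with hf
  have hc : Continuous f := by fun_prop
  have hV' : ∀ᶠ ε in 𝓝[>] (0 : ℝ), f ε ∈ V :=
    nhdsWithin_le_nhds (hc.continuousAt.preimage_mem_nhds (by simpa [hf] using hV))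
  obtain ⟨ε, hε, hpos⟩ := (hV'.and self_mem_nhdsWithin).exists
  have hpos : 0 < ε := hpos
  have hout : ∀ i ∉ D, A i ⬝ᵥ x < (f ε).2 i := fun i hi => by
    have := hx i
    simp [hf, hi]
    linarith
  have hin : ∀ i ∈ D, A i ⬝ᵥ x = (f ε).2 i := fun i hi => by simp [hf, hi, h1 i hi]
  have hl : ∀ i ∈ D, 0 < l i + ε := fun i hi => by linarith [h2 i hi]
  refine ⟨f ε, hε, fun i => l i + ε, ⟨fun i => ?_, hin, fun i hi => (hl i hi).le, ?_⟩, hl, hout⟩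
  · by_cases hi : i ∈ D
    exacts [(hin i hi).le, (hout i hi).le]
  · ext j
    have h4 := congrFun h3 j
    have h5 : (∑ i ∈ D, A i) j = ∑ i ∈ D, A i j := Finset.sum_apply j D fun i => A i
    simp only [Pi.add_apply, Finset.sum_apply, Pi.smul_apply, smul_eq_mul, Pi.zero_apply] at h4
    simp only [hf, Pi.add_apply, Pi.sub_apply, Finset.sum_apply, Pi.smul_apply, smul_eq_mul,
      Pi.zero_apply, add_mul, Finset.sum_add_distrib, ← Finset.mul_sum, h5]
    linarith

end KKT

theorem exists_seminorm_sub_lt {n : ℕ} {N : Seminorm ℝ (Fin n → ℝ)} {S : Set (Fin n → ℝ)}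
    {z : Fin n → ℝ} {δ : ℝ} (h : setDist N z S < ENNReal.ofReal δ) :
    ∃ y ∈ S, N (z - y) < δ := by
  simp only [setDist, iInf_lt_iff] at h
  obtain ⟨y, hy, h⟩ := h
  refine ⟨y, hy, ?_⟩
  by_contra! hle
  exact absurd h (not_lt.2 (ENNReal.ofReal_le_ofReal hle))

/-! ### Necessity of nonsingularity and the lower bound for the modulus -/

section LowerBound

variable {n m : ℕ} {Q : Matrix (Fin n) (Fin n) ℝ} {A : Matrix (Fin m) (Fin n) ℝ}
  {N : Seminorm ℝ (Fin n → ℝ)} {c : Fin n → ℝ} {b : Fin m → ℝ} {x : Fin n → ℝ}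

/-- After passing to a strictly complementary parameter `q`, tilt the cost by `τ u`. The Lipschitz
estimate demands a solution `y` near `x`, but from `y` one can move along `-u` feasibly with
strictly decreasing objective. -/
theorem eq_zero_of_isLipschitzConstAt (hQ : Q.PosSemidef) (hN : ∀ x, N x = 0 → x = 0)
    {κ : ℝ≥0} (hκ : IsLipschitzConstAt (paramNorm N) N (argminMap Q A) (c, b) x κ)
    (hx : x ∈ feasibleSet A b) {D : Finset (Fin m)} (hD : IsKKTSet Q A c b x D)
    {u : Fin n → ℝ} (hQu : Q *ᵥ u = 0) (hAu : ∀ i ∈ D, A i ⬝ᵥ u = 0) : u = 0 := by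
  obtain ⟨U, hU, V, hV, hUV⟩ := hκ
  obtain ⟨q, hq, l, hl, -, hout⟩ := hD.exists_strict hx (eventually_mem_nhds_iff.2 hV)
  by_contra hu
  have huu : 0 < u ⬝ᵥ u := by
    refine lt_of_le_of_ne (Finset.sum_nonneg fun i _ => mul_self_nonneg _) fun h => hu ?_
    exact dotProduct_self_eq_zero.1 h.symm
  -- Within `N`-distance `δ` of `x`, the constraints outside `D` remain slack for `q`.
  obtain ⟨δ, hδ, hW⟩ : ∃ δ : ℝ, 0 < δ ∧ ∀ y, N (x - y) < δ → ∀ i ∉ D, A i ⬝ᵥ y < q.2 i := by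
    have hW : ∀ᶠ y in 𝓝 x, ∀ i, i ∉ D → A i ⬝ᵥ y < q.2 i := by
      refine eventually_all.2 fun i => ?_
      by_cases hi : i ∈ D
      · simp [hi]
      · have hc : Continuous fun y : Fin n → ℝ => A i ⬝ᵥ y := by fun_prop
        filter_upwards [hc.continuousAt.eventually_lt_const (hout i hi)] with y hy _ using hy
    obtain ⟨r, hr, hball⟩ := Metric.eventually_nhds_iff.1 hW
    obtain ⟨K, hK, hle⟩ := exists_norm_le hN
    refine ⟨r / K, div_pos hr hK, fun y hy => hball ?_⟩
    rw [dist_eq_norm, norm_sub_rev]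
    rw [lt_div_iff₀ hK] at hy
    linarith [hle (x - y)]
  set f : ℝ → (Fin n → ℝ) × (Fin m → ℝ) := fun τ => q + τ • (u, 0) with hf
  have hc : Continuous f := by fun_prop
  have hf0 : f 0 = q := by simp [hf]
  have h1 : ∀ᶠ τ in 𝓝[>] (0 : ℝ), f τ ∈ V :=
    nhdsWithin_le_nhds (hc.continuousAt.preimage_mem_nhds (by rw [hf0]; exact hq))
  have h2 : ∀ᶠ τ in 𝓝[>] (0 : ℝ), κ * (τ * paramNorm N ((u, 0) : _ × (Fin m → ℝ))) < δ := by
    have hc : Continuous fun τ : ℝ => κ * (τ * paramNorm N ((u, 0) : _ × (Fin m → ℝ))) := by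
      fun_prop
    exact nhdsWithin_le_nhds (hc.continuousAt.eventually_lt_const (by simpa using hδ))
  obtain ⟨τ, hτV, hτδ, hτ⟩ := (h1.and (h2.and self_mem_nhdsWithin)).exists
  have hτ : 0 < τ := hτ
  have hdist := hUV (f τ) hτV q (mem_of_mem_nhds hq) x ⟨hl.mem_argminMap hQ, mem_of_mem_nhds hU⟩
  have hqf : paramNorm N (q - f τ) = τ * paramNorm N ((u, 0) : _ × (Fin m → ℝ)) := by
    rw [show q - f τ = (-τ) • ((u, 0) : _ × (Fin m → ℝ)) by simp [hf], paramNorm_smul, abs_neg,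
      abs_of_pos hτ]
  obtain ⟨y, hy, hxy⟩ : ∃ y ∈ argminMap Q A (f τ), N (x - y) < δ := by
    refine exists_seminorm_sub_lt (hdist.trans_lt ?_)
    rw [hqf, ← ENNReal.ofReal_coe_nnreal, ← ENNReal.ofReal_mul κ.coe_nonneg,
      ENNReal.ofReal_lt_ofReal_iff hδ]
    exact hτδ
  have hout' := hW y hxy
  have hf2 : (f τ).2 = q.2 := by simp [hf]
  -- Constraints in `D` are constant along `u`, and the others are strict at `y`.
  have hfeas : ∀ᶠ ε in 𝓝[>] (0 : ℝ), y + ε • (-u) ∈ feasibleSet A (f τ).2 := by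
    simp only [feasibleSet, mem_ofPred_eq]
    refine eventually_all.2 fun i => ?_
    by_cases hi : i ∈ D
    · filter_upwards with ε
      simpa [dotProduct_add, dotProduct_smul, dotProduct_neg, hAu i hi] using hy.1 i
    · have hc : Continuous fun ε : ℝ => A i ⬝ᵥ (y + ε • (-u)) := by fun_prop
      have := (hc.tendsto 0).eventually_lt_const (u := q.2 i) (by simpa using hout' i hi)
      filter_upwards [nhdsWithin_le_nhds this] with ε hε
      rw [hf2]
      exact hε.le
  obtain ⟨ε, hεf, hε⟩ := (hfeas.and self_mem_nhdsWithin).exists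
  have hε : 0 < ε := hε
  have hmin := hy.2 _ hεf
  -- Stationarity at `x` shows that the untilted cost is constant along `u`. Only the tilt
  -- contributes, changing the objective by `-ε τ u'u`.
  have hqu : q.1 ⬝ᵥ u = 0 := by
    have h3 := hl.gradient_dotProduct u
    rw [Finset.sum_eq_zero fun i hi => by rw [hAu i hi, mul_zero], add_dotProduct] at h3
    have h4 : (Q *ᵥ x) ⬝ᵥ u = 0 := by
      have hsymm : Qᵀ = Q := by simpa using hQ.isHermitian.eq
      rw [dotProduct_comm, Matrix.dotProduct_mulVec, ← Matrix.mulVec_transpose, hsymm, hQu,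
        zero_dotProduct]
    linarith
  have hyu : (Q *ᵥ y) ⬝ᵥ u = 0 := by
    have hsymm : Qᵀ = Q := by simpa using hQ.isHermitian.eq
    rw [dotProduct_comm, Matrix.dotProduct_mulVec, ← Matrix.mulVec_transpose, hsymm, hQu,
      zero_dotProduct]
  rw [objective_add hQ] at hmin
  have hf1 : (f τ).1 = q.1 + τ • u := by simp [hf]
  simp only [hf1, Matrix.mulVec_smul, Matrix.mulVec_neg, hQu, neg_zero, smul_zero,
    dotProduct_zero, mul_zero, add_zero, dotProduct_smul, dotProduct_neg, add_dotProduct,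
    smul_dotProduct, hqu, hyu, smul_eq_mul, zero_add] at hmin
  have : 0 < ε * (τ * (u ⬝ᵥ u)) := by positivity
  linarith

theorem isUnit_kktMatrix_of_isLipschitzConstAt (hQ : Q.PosSemidef) (hN : ∀ x, N x = 0 → x = 0)
    {κ : ℝ≥0} (hκ : IsLipschitzConstAt (paramNorm N) N (argminMap Q A) (c, b) x κ)
    (hx : x ∈ feasibleSet A b) {D : Finset (Fin m)} (hD : D ∈ extendedKKTSets Q A c b x) :
    IsUnit (kktMatrix Q A D) :=
  (isUnit_kktMatrix_iff hQ).2
    ⟨hD.2, fun _ h1 h2 => eq_zero_of_isLipschitzConstAt hQ hN hκ hx hD.1 h1 h2⟩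

theorem opNorm_le_of_isLipschitzConstAt (hQ : Q.PosSemidef)
    {κ : ℝ≥0} (hκ : IsLipschitzConstAt (paramNorm N) N (argminMap Q A) (c, b) x κ)
    (hx : x ∈ feasibleSet A b) {D : Finset (Fin m)} (hD : IsKKTSet Q A c b x D)
    (hunit : IsUnit (kktMatrix Q A D)) :
    opNorm N (solutionMatrix Q A D) ≤ κ := by
  classical
  obtain ⟨U, hU, V, hV, hUV⟩ := hκ
  obtain ⟨q, hq, l, hl, hlpos, hout⟩ := hD.exists_strict hx (eventually_mem_nhds_iff.2 hV)
  have hsol := hl.eq_kktSolution hunit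
  refine opNorm_le κ.coe_nonneg fun α β => ?_
  -- The right-hand side of the KKT system is `(-c, b_D)`, so this direction changes it by `(α, β)`.
  -- Extension by zero outside `D` keeps the norm of `w` at most that of `(α, β)`.
  set w : (Fin n → ℝ) × (Fin m → ℝ) := (-α, fun i => if h : i ∈ D then β ⟨i, h⟩ else 0) with hw
  set f : ℝ → (Fin n → ℝ) × (Fin m → ℝ) := fun τ => q + τ • w with hf
  have hc : Continuous f := by fun_prop
  have hf0 : f 0 = q := by simp [hf]
  have hcs : Continuous fun τ => kktSolution Q A D (f τ) := (continuous_kktSolution D).comp hc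
  have h1 : ∀ᶠ τ in 𝓝[>] (0 : ℝ), f τ ∈ V :=
    nhdsWithin_le_nhds (hc.continuousAt.preimage_mem_nhds (by rw [hf0]; exact hq))
  have h2 : ∀ᶠ τ in 𝓝[>] (0 : ℝ), ∀ i : D, 0 < kktSolution Q A D (f τ) (Sum.inr i) := by
    refine nhdsWithin_le_nhds (eventually_all.2 fun i => ?_)
    have hc' : Continuous fun τ => kktSolution Q A D (f τ) (Sum.inr i) :=
      (continuous_apply _).comp hcs
    refine hc'.continuousAt.eventually_const_lt ?_
    change 0 < kktSolution Q A D (f 0) (Sum.inr i)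
    rw [hf0, hsol]
    exact hlpos i i.2
  have h3 : ∀ᶠ τ in 𝓝[>] (0 : ℝ), ∀ i, i ∉ D →
      A i ⬝ᵥ (kktSolution Q A D (f τ) ∘ Sum.inl) < (f τ).2 i := by
    refine nhdsWithin_le_nhds (eventually_all.2 fun i => ?_)
    by_cases hi : i ∈ D
    · simp [hi]
    have hc1 : Continuous fun τ => A i ⬝ᵥ (kktSolution Q A D (f τ) ∘ Sum.inl) :=
      continuous_const.dotProduct (continuous_pi fun j => (continuous_apply _).comp hcs)
    have hc2 : Continuous fun τ => (f τ).2 i := (continuous_apply i).comp hc.snd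
    have : A i ⬝ᵥ (kktSolution Q A D (f 0) ∘ Sum.inl) < (f 0).2 i := by
      rw [hf0, hsol, Sum.elim_comp_inl]
      exact hout i hi
    filter_upwards [hc1.continuousAt.eventually_lt hc2.continuousAt this] with τ hτ _ using hτ
  obtain ⟨τ, hτV, hτl, hτ3, hτ⟩ := (h1.and (h2.and (h3.and self_mem_nhdsWithin))).exists
  have hτ : 0 < τ := hτ
  set y := kktSolution Q A D (f τ) ∘ Sum.inl with hy
  have hkkt : IsKKTPoint Q A (f τ) D y
      (fun i => if h : i ∈ D then kktSolution Q A D (f τ) (Sum.inr ⟨i, h⟩) else 0) := by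
    refine isKKTPoint_kktSolution hunit (fun i => ?_) (fun i => by simp)
      fun i hi => by simpa [hi] using (hτl ⟨i, hi⟩).le
    by_cases hi : i ∈ D
    · have hdet := (Matrix.isUnit_iff_isUnit_det _).1 hunit
      have h : kktMatrix Q A D *ᵥ Sum.elim (kktSolution Q A D (f τ) ∘ Sum.inl)
          (kktSolution Q A D (f τ) ∘ Sum.inr) =
            Sum.elim (-(f τ).1) (fun i : D => (f τ).2 i) := by
        rw [Sum.elim_comp_inl_inr, kktSolution, Matrix.mulVec_mulVec,
          Matrix.mul_nonsing_inv _ hdet, Matrix.one_mulVec]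
      rw [kktMatrix_mulVec, Sum.elim_eq_iff] at h
      exact (congrFun h.2 ⟨i, hi⟩).le
    · exact (hτ3 i hi).le
  -- With a single solution the distance to the solution set is exactly `N (x - y)`, so the
  -- Lipschitz estimate bounds the affine branch itself.
  have hsingle : argminMap Q A (f τ) ⊆ {y} := fun z hz =>
    hkkt.eq_of_mem_argminMap hQ (fun i hi => by simpa [hi] using hτl ⟨i, hi⟩)
      ((isUnit_kktMatrix_iff hQ).1 hunit).2 hz
  have hdist := hUV (f τ) hτV q (mem_of_mem_nhds hq) x ⟨hl.mem_argminMap hQ, mem_of_mem_nhds hU⟩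
  have hle : N (x - y) ≤ κ * paramNorm N (q - f τ) := by
    have h4 : ENNReal.ofReal (N (x - y)) ≤ setDist N x (argminMap Q A (f τ)) :=
      le_iInf₂ fun z hz => by rw [hsingle hz]
    have h5 := h4.trans hdist
    rw [← ENNReal.ofReal_coe_nnreal, ← ENNReal.ofReal_mul κ.coe_nonneg] at h5
    exact (ENNReal.ofReal_le_ofReal_iff
      (mul_nonneg κ.coe_nonneg (paramNorm_nonneg _))).1 h5
  have hxy : x - y = (-τ) • (solutionMatrix Q A D *ᵥ Sum.elim α β) := by
    rw [← Matrix.mulVec_smul, solutionMatrix_mulVec]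
    have : x = kktSolution Q A D q ∘ Sum.inl := by rw [hsol, Sum.elim_comp_inl]
    rw [hy, this]
    change (kktSolution Q A D q - kktSolution Q A D (f τ)) ∘ Sum.inl = _
    rw [kktSolution_sub, kktSolution]
    congr 2
    ext (i | i) <;> simp [hf, hw]
  have hqf : q - f τ = (-τ) • w := by simp [hf]
  rw [hxy, hqf, paramNorm_smul, map_smul_eq_mul, Real.norm_eq_abs, abs_neg, abs_of_pos hτ,
    mul_left_comm] at hle
  refine (le_of_mul_le_mul_left hle hτ).trans (mul_le_mul_of_nonneg_left ?_ κ.coe_nonneg)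
  refine max_le_max (by rw [hw, dualNorm_neg]) ?_
  refine (pi_norm_le_iff_of_nonneg (norm_nonneg _)).2 fun i => ?_
  by_cases hi : i ∈ D
  · simpa [hw, hi] using norm_le_pi_norm β ⟨i, hi⟩
  · simp [hw, hi]

end LowerBound

/-- Continuous induction on `[0, 1]`: the set where the estimate from `0` holds is closed, and it
can be continued to the right of each of its points below `1`. Continuity of `f` is not presupposed;
closedness of the pieces replaces it. -/
theorem seminorm_sub_le_of_closed_cover {ι E : Type*} [AddCommGroup E] [Module ℝ E]
    [TopologicalSpace E] [IsTopologicalAddGroup E] {N : Seminorm ℝ E} (hN : Continuous N)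
    {s : Set ι} (hs : s.Finite)
    {f : ℝ → E} {g : ι → ℝ → E} {T : ι → Set ℝ} (hT : ∀ i ∈ s, IsClosed (T i))
    (hcover : ∀ t ∈ Icc (0 : ℝ) 1, ∃ i ∈ s, t ∈ T i)
    (hfg : ∀ i ∈ s, ∀ t ∈ Icc (0 : ℝ) 1, t ∈ T i → f t = g i t)
    (hg : ∀ i ∈ s, Continuous (g i)) {K : ℝ}
    (hlip : ∀ i ∈ s, ∀ r t, r ≤ t → N (g i t - g i r) ≤ K * (t - r)) :
    N (f 1 - f 0) ≤ K := by
  set G : Set ℝ := {t | N (f t - f 0) ≤ K * t} with hG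
  have hclosed : IsClosed (G ∩ Icc 0 1) := by
    have : G ∩ Icc 0 1 = ⋃ i ∈ s, (T i ∩ {t | N (g i t - f 0) ≤ K * t}) ∩ Icc 0 1 := by
      ext t
      simp only [mem_iUnion, mem_inter_iff]
      constructor
      · rintro ⟨h1, h2⟩
        obtain ⟨i, hi, hti⟩ := hcover t h2
        refine ⟨i, hi, ⟨hti, ?_⟩, h2⟩
        rw [mem_ofPred_eq, ← hfg i hi t h2 hti]
        exact h1
      · rintro ⟨i, hi, ⟨hti, h1⟩, h2⟩
        refine ⟨?_, h2⟩
        rw [hG, mem_ofPred_eq, hfg i hi t h2 hti]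
        exact h1
    rw [this]
    refine hs.isClosed_biUnion fun i hi => ((hT i hi).inter ?_).inter isClosed_Icc
    exact isClosed_le (hN.comp ((hg i hi).sub continuous_const)) (by fun_prop)
  have key : Icc (0 : ℝ) 1 ⊆ G := by
    refine hclosed.Icc_subset_of_forall_exists_gt (by simp [hG]) ?_
    rintro t ⟨htG, ht⟩ y hy
    have hev : ∀ᶠ r in 𝓝[>] t, r ∈ Ioc t (min y 1) :=
      Ioc_mem_nhdsGT (lt_min hy ht.2)
    -- There are finitely many pieces, so one of them meets every right neighbourhood of `t`. Being
    -- closed it contains `t`, and a single branch governs the increment from `t` to some later `r`.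
    obtain ⟨i, hi, hfreq⟩ : ∃ i ∈ s, ∃ᶠ r in 𝓝[>] t, r ∈ T i := by
      by_contra! hcon
      have h1 : ∀ᶠ r in 𝓝[>] t, ∀ i ∈ s, r ∉ T i :=
        (eventually_all_finite hs).2 fun i hi => hcon i hi
      obtain ⟨r, hr1, hr2⟩ := (h1.and hev).exists
      obtain ⟨i, hi, hri⟩ := hcover r ⟨ht.1.trans hr2.1.le, hr2.2.trans (min_le_right _ _)⟩
      exact hr1 i hi hri
    have htT : t ∈ T i :=
      (hT i hi).mem_of_frequently_of_tendsto hfreq (tendsto_id'.2 nhdsWithin_le_nhds)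
    obtain ⟨r, hr1, hr2⟩ := (hfreq.and_eventually hev).exists
    refine ⟨r, ?_, hr2.1, hr2.2.trans (min_le_left _ _)⟩
    rw [hG, mem_ofPred_eq] at htG ⊢
    have hr3 : r ∈ Icc (0 : ℝ) 1 := ⟨ht.1.trans hr2.1.le, hr2.2.trans (min_le_right _ _)⟩
    have h1 := hlip i hi t r hr2.1.le
    rw [← hfg i hi t ⟨ht.1, ht.2.le⟩ htT, ← hfg i hi r hr3 hr1] at h1
    calc N (f r - f 0) = N ((f r - f t) + (f t - f 0)) := by rw [sub_add_sub_cancel]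
      _ ≤ N (f r - f t) + N (f t - f 0) := map_add_le_add N _ _
      _ ≤ K * r := by linarith
  simpa [hG] using key (right_mem_Icc.2 zero_le_one)

/-! ### Stability of solutions and the upper bound for the modulus -/

section UpperBound

variable {n m : ℕ} {Q : Matrix (Fin n) (Fin n) ℝ} {A : Matrix (Fin m) (Fin n) ℝ}
  {N : Seminorm ℝ (Fin n → ℝ)} {c : Fin n → ℝ} {b : Fin m → ℝ} {x : Fin n → ℝ}

/-- For fixed `D`, being a KKT set is a closed condition on parameter and point, because the
generated cone is closed; only finitely many `D` occur. Thus no new KKT sets appear nearby. -/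
theorem eventually_isKKTSet (Q : Matrix (Fin n) (Fin n) ℝ) (A : Matrix (Fin m) (Fin n) ℝ)
    (c : Fin n → ℝ) (b : Fin m → ℝ) (x : Fin n → ℝ) :
    ∀ᶠ z : ((Fin n → ℝ) × (Fin m → ℝ)) × (Fin n → ℝ) in 𝓝 ((c, b), x),
      ∀ D, IsKKTSet Q A z.1.1 z.1.2 z.2 D → IsKKTSet Q A c b x D := by
  refine eventually_all.2 fun D => ?_
  by_cases hD : IsKKTSet Q A c b x D
  · simp [hD]
  suffices H : ∀ᶠ z : ((Fin n → ℝ) × (Fin m → ℝ)) × (Fin n → ℝ) in 𝓝 ((c, b), x),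
      ¬ IsKKTSet Q A z.1.1 z.1.2 z.2 D from H.mono fun z hz h => absurd h hz
  refine IsOpen.mem_nhds ?_ hD
  rw [← isClosed_compl_iff]
  have hcl := (isClosed_hull_image_finset (fun i => A i) D).preimage
    (show Continuous fun z : ((Fin n → ℝ) × (Fin m → ℝ)) × (Fin n → ℝ) =>
      -(Q *ᵥ z.2 + z.1.1) by fun_prop)
  have hact : IsClosed {z : ((Fin n → ℝ) × (Fin m → ℝ)) × (Fin n → ℝ) |
      ∀ i ∈ D, A i ⬝ᵥ z.2 = z.1.2 i} := by
    simp only [ofPred_forall]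
    exact isClosed_iInter fun i => isClosed_iInter fun _ =>
      isClosed_eq (by fun_prop) (by fun_prop)
  convert hact.inter hcl using 1
  ext z
  simp [IsKKTSet, activeIndices, subset_def]

theorem SlaterCQ.exists_strict_mem (h : SlaterCQ A b) (hx : x ∈ feasibleSet A b)
    {W : Set (Fin n → ℝ)} (hW : W ∈ 𝓝 x) : ∃ y ∈ W, ∀ i, A i ⬝ᵥ y < b i := by
  obtain ⟨z, hz⟩ := h
  have hc : Continuous fun s : ℝ => x + s • (z - x) := by fun_prop
  have h1 : ∀ᶠ s in 𝓝[>] (0 : ℝ), x + s • (z - x) ∈ W :=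
    nhdsWithin_le_nhds (hc.continuousAt.preimage_mem_nhds (by simpa using hW))
  have h2 : ∀ᶠ s in 𝓝[>] (0 : ℝ), s ∈ Ioc (0 : ℝ) 1 := Ioc_mem_nhdsGT one_pos
  obtain ⟨s, hs1, hs2⟩ := (h1.and h2).exists
  refine ⟨_, hs1, fun i => ?_⟩
  simp only [dotProduct_add, dotProduct_smul, dotProduct_sub, smul_eq_mul]
  nlinarith [mul_pos hs2.1 (sub_pos.2 (hz i)),
    mul_nonneg (sub_nonneg.2 hs2.2) (sub_nonneg.2 (hx i))]

theorem continuous_objective :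
    Continuous fun z : (Fin n → ℝ) × (Fin n → ℝ) => objective Q z.1 z.2 := by
  unfold objective
  fun_prop

theorem isClosed_feasibleSet : IsClosed (feasibleSet A b) := by
  simp only [feasibleSet, ofPred_forall]
  exact isClosed_iInter fun i => isClosed_le (by fun_prop) continuous_const

theorem isOpen_strictlyFeasible (A : Matrix (Fin m) (Fin n) ℝ) :
    IsOpen {z : (Fin m → ℝ) × (Fin n → ℝ) | ∀ i, A i ⬝ᵥ z.2 < z.1 i} := by
  simp only [ofPred_forall]
  exact isOpen_iInter_of_finite fun i => isOpen_lt (by fun_prop) (by fun_prop)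

theorem mem_argminMap_of_local (hQ : Q.PosSemidef) {p : (Fin n → ℝ) × (Fin m → ℝ)}
    {W : Set (Fin n → ℝ)} {w : Fin n → ℝ} (hW : W ∈ 𝓝 w) (hw : w ∈ feasibleSet A p.2)
    (hmin : ∀ y ∈ W, y ∈ feasibleSet A p.2 → objective Q p.1 w ≤ objective Q p.1 y) :
    w ∈ argminMap Q A p := by
  refine ⟨hw, fun y hy => ?_⟩
  have hc : Continuous fun s : ℝ => w + s • (y - w) := by fun_prop
  have h1 : ∀ᶠ s in 𝓝[>] (0 : ℝ), w + s • (y - w) ∈ W :=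
    nhdsWithin_le_nhds (hc.continuousAt.preimage_mem_nhds (by simpa using hW))
  have h2 : ∀ᶠ s in 𝓝[>] (0 : ℝ), s ∈ Ioc (0 : ℝ) 1 := Ioc_mem_nhdsGT one_pos
  obtain ⟨s, hs1, hs2⟩ := (h1.and h2).exists
  have h3 := hmin _ hs1 fun i => by
    simp only [dotProduct_add, dotProduct_smul, dotProduct_sub, smul_eq_mul]
    nlinarith [mul_nonneg hs2.1.le (sub_nonneg.2 (hy i)),
      mul_nonneg (sub_nonneg.2 hs2.2) (sub_nonneg.2 (hw i))]
  rw [objective_add hQ, Matrix.mulVec_smul] at h3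
  simp only [dotProduct_smul, smul_dotProduct, smul_eq_mul] at h3
  have h4 := quadratic_nonneg hQ (y - w)
  rw [objective_eq hQ p.1 w y]
  have h5 : 0 ≤ (Q *ᵥ w + p.1) ⬝ᵥ (y - w) + 1 / 2 * s * ((y - w) ⬝ᵥ Q *ᵥ (y - w)) := by
    refine le_of_mul_le_mul_left ?_ hs2.1
    linarith
  nlinarith [mul_nonneg (sub_nonneg.2 hs2.2) h4]

/-- Minimize over a small closed ball around `x`. By uniqueness, each point of the sphere is either
infeasible or strictly worse than `x`, hence worse than some strictly feasible point near `x`. Both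
alternatives survive perturbation, so the minimizer is interior, and convexity makes it global. -/
theorem eventually_exists_mem_argminMap (hQ : Q.PosSemidef) (hSCQ : SlaterCQ A b)
    (hS : argminMap Q A (c, b) = {x}) {U : Set (Fin n → ℝ)} (hU : U ∈ 𝓝 x) :
    ∀ᶠ q in 𝓝 (c, b), ∃ y ∈ U, y ∈ argminMap Q A q := by
  have hx : x ∈ argminMap Q A (c, b) := by rw [hS]; rfl
  obtain ⟨r, hr, hrU⟩ := Metric.nhds_basis_closedBall.mem_iff.1 hU
  have hsphere : ∀ w ∈ Metric.sphere x r,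
      ∀ᶠ z : ((Fin n → ℝ) × (Fin m → ℝ)) × (Fin n → ℝ) in 𝓝 ((c, b), w),
        z.2 ∈ feasibleSet A z.1.2 → ∃ y ∈ Metric.closedBall x r, y ∈ feasibleSet A z.1.2 ∧
          objective Q z.1.1 y < objective Q z.1.1 z.2 := by
    intro w hw
    by_cases hwf : w ∈ feasibleSet A b
    · have hlt : objective Q c x < objective Q c w := by
        by_contra! hle
        have : w ∈ argminMap Q A (c, b) := ⟨hwf, fun y hy => hle.trans (hx.2 y hy)⟩
        rw [hS, mem_singleton_iff] at this
        rw [this, mem_sphere_iff_norm, sub_self, norm_zero] at hw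
        exact hr.ne hw
      have hc : Continuous fun y => objective Q c y :=
        continuous_objective.comp (continuous_const.prodMk continuous_id)
      obtain ⟨y, ⟨hy1, hy2⟩, hy3⟩ := hSCQ.exists_strict_mem hx.1
        (inter_mem (Metric.closedBall_mem_nhds x hr) (hc.continuousAt.eventually_lt_const hlt))
      have h1 : ∀ᶠ z : ((Fin n → ℝ) × (Fin m → ℝ)) × (Fin n → ℝ) in 𝓝 ((c, b), w),
          ∀ i, A i ⬝ᵥ y < z.1.2 i :=
        ((isOpen_strictlyFeasible A).preimage
          (show Continuous fun z : ((Fin n → ℝ) × (Fin m → ℝ)) × (Fin n → ℝ) => (z.1.2, y) by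
            fun_prop)).mem_nhds hy3
      have h2 : ∀ᶠ z : ((Fin n → ℝ) × (Fin m → ℝ)) × (Fin n → ℝ) in 𝓝 ((c, b), w),
          objective Q z.1.1 y < objective Q z.1.1 z.2 := by
        refine (isOpen_lt ?_ ?_).mem_nhds hy2
        · exact continuous_objective.comp (continuous_fst.fst.prodMk continuous_const)
        · exact continuous_objective.comp (continuous_fst.fst.prodMk continuous_snd)
      filter_upwards [h1, h2] with z hz1 hz2 _
      exact ⟨y, hy1, fun i => (hz1 i).le, hz2⟩
    · obtain ⟨i, hi⟩ : ∃ i, b i < A i ⬝ᵥ w := by simpa [feasibleSet] using hwf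
      have h1 : ∀ᶠ z : ((Fin n → ℝ) × (Fin m → ℝ)) × (Fin n → ℝ) in 𝓝 ((c, b), w),
          z.1.2 i < A i ⬝ᵥ z.2 :=
        (isOpen_lt (by fun_prop) (by fun_prop)).mem_nhds hi
      filter_upwards [h1] with z hz hzf
      exact absurd (hzf i) (not_le.2 hz)
  -- Compactness of the sphere yields one neighbourhood of `(c, b)` that serves all its points.
  have hall := (isCompact_sphere x r).eventually_forall_of_forall_eventually
    (P := fun (q : (Fin n → ℝ) × (Fin m → ℝ)) w => w ∈ feasibleSet A q.2 → ∃ y ∈ Metric.closedBall x r, y ∈ feasibleSet A q.2 ∧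
          objective Q q.1 y < objective Q q.1 w) hsphere
  obtain ⟨y, hy1, hy2⟩ := hSCQ.exists_strict_mem hx.1 (Metric.closedBall_mem_nhds x hr)
  have hfeas : ∀ᶠ q : (Fin n → ℝ) × (Fin m → ℝ) in 𝓝 (c, b), ∀ i, A i ⬝ᵥ y < q.2 i :=
    ((isOpen_strictlyFeasible A).preimage
      (show Continuous fun q : (Fin n → ℝ) × (Fin m → ℝ) => (q.2, y) by fun_prop)).mem_nhds hy2
  filter_upwards [hall, hfeas] with q hq1 hq2
  have hcomp : IsCompact (Metric.closedBall x r ∩ feasibleSet A q.2) :=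
    (isCompact_closedBall x r).inter_right isClosed_feasibleSet
  obtain ⟨w, ⟨hw1, hw2⟩, hw3⟩ := hcomp.exists_isMinOn ⟨y, hy1, fun i => (hq2 i).le⟩
    (f := fun y => objective Q q.1 y)
    (continuous_objective.comp (continuous_const.prodMk continuous_id)).continuousOn
  have hball : w ∈ Metric.ball x r := by
    refine lt_of_le_of_ne (Metric.mem_closedBall.1 hw1) fun heq => ?_
    obtain ⟨y', hy1', hy2', hy3'⟩ := hq1 w heq hw2
    exact absurd (hw3 ⟨hy1', hy2'⟩) (not_le.2 hy3')
  exact ⟨w, hrU hw1, mem_argminMap_of_local hQ (Metric.isOpen_ball.mem_nhds hball) hw2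
    fun y' h1 h2 => hw3 ⟨Metric.ball_subset_closedBall h1, h2⟩⟩

theorem isLipschitzConstAt_of_opNorm_le (hQ : Q.PosSemidef) (hN : ∀ x, N x = 0 → x = 0)
    (hSCQ : SlaterCQ A b) (hS : argminMap Q A (c, b) = {x})
    (hunit : ∀ D ∈ extendedKKTSets Q A c b x, IsUnit (kktMatrix Q A D)) {κ : ℝ≥0}
    (hκ : ∀ D ∈ extendedKKTSets Q A c b x, opNorm N (solutionMatrix Q A D) ≤ κ) :
    IsLipschitzConstAt (paramNorm N) N (argminMap Q A) (c, b) x κ := by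
  classical
  have hKKT := eventually_isKKTSet Q A c b x
  rw [nhds_prod_eq] at hKKT
  obtain ⟨V₁, hV₁, U, hU, hVU⟩ := mem_prod_iff.1 hKKT
  have hex := eventually_exists_mem_argminMap hQ hSCQ hS hU
  obtain ⟨ρ, hρ, hball⟩ := Metric.eventually_nhds_iff_ball.1 (hex.and hV₁)
  -- A minimal KKT set at `(q, y)` has positive multipliers and is a KKT set at the reference point,
  -- so it belongs to `𝓛`. Nonsingularity of its matrix then makes `y` the only solution.
  have hsel : ∀ q ∈ Metric.ball (c, b) ρ, ∃ y ∈ argminMap Q A q,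
      (∀ z ∈ argminMap Q A q, z = y) ∧ ∃ D ∈ extendedKKTSets Q A c b x, ∃ l,
        IsKKTPoint Q A q D y l := by
    intro q hq
    obtain ⟨⟨y, hyU, hy⟩, hqV⟩ := hball q hq
    obtain ⟨D, l, hD, hl, hpos⟩ := exists_isKKTPoint_pos hQ hy
    have hD' : D ∈ extendedKKTSets Q A c b x :=
      ⟨hVU (show (q, y) ∈ V₁ ×ˢ U from ⟨hqV, hyU⟩) D hD.1, hD.2⟩
    exact ⟨y, hy, fun z hz => hl.eq_of_mem_argminMap hQ hpos
      ((isUnit_kktMatrix_iff hQ).1 (hunit D hD')).2 hz, D, hD', l, hl⟩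
  choose! X hX hXuniq hXD using hsel
  -- No localization in `x` is needed, since the solution map is single-valued on the whole ball.
  refine ⟨univ, univ_mem, Metric.ball (c, b) ρ, Metric.ball_mem_nhds _ hρ, ?_⟩
  rintro y₁ hy₁ y₂ hy₂ x₂ ⟨hx₂, -⟩
  set γ : ℝ → (Fin n → ℝ) × (Fin m → ℝ) := fun t => y₁ + t • (y₂ - y₁) with hγ
  have hγc : Continuous γ := by fun_prop
  have hγ0 : γ 0 = y₁ := by simp [hγ]
  have hγ1 : γ 1 = y₂ := by simp [hγ]
  have hγV : ∀ t ∈ Icc (0 : ℝ) 1, γ t ∈ Metric.ball (c, b) ρ := fun t ht =>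
    (convex_ball (c, b) ρ).add_smul_sub_mem hy₁ hy₂ ht
  have hsolc : ∀ D, Continuous fun t => kktSolution Q A D (γ t) := fun D =>
    (continuous_kktSolution D).comp hγc
  have hgc : ∀ D, Continuous fun t => kktSolution Q A D (γ t) ∘ Sum.inl := fun D =>
    continuous_pi fun j => (continuous_apply _).comp (hsolc D)
  have hbound : N (X (γ 1) - X (γ 0)) ≤ κ * paramNorm N (y₂ - y₁) := by
    -- The piece of `D` consists of the `t` at which the affine branch of `D` is feasible with
    -- nonnegative multipliers. These conditions are closed and force the branch to coincide with
    -- the unique solution.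
    refine seminorm_sub_le_of_closed_cover (f := fun t => X (γ t)) (continuous_seminorm N)
      (toFinite (extendedKKTSets Q A c b x)) (g := fun D t => kktSolution Q A D (γ t) ∘ Sum.inl)
      (T := fun D => {t | kktSolution Q A D (γ t) ∘ Sum.inl ∈ feasibleSet A (γ t).2 ∧
        ∀ i : D, 0 ≤ kktSolution Q A D (γ t) (Sum.inr i)}) ?_ ?_ ?_ (fun D _ => hgc D) ?_
    · intro D hD
      have h1 : IsClosed {t | ∀ i, A i ⬝ᵥ (kktSolution Q A D (γ t) ∘ Sum.inl) ≤ (γ t).2 i} := by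
        simp only [ofPred_forall]
        exact isClosed_iInter fun i => isClosed_le (continuous_const.dotProduct (hgc D))
          ((continuous_apply i).comp hγc.snd)
      have h2 : IsClosed {t | ∀ i : D, 0 ≤ kktSolution Q A D (γ t) (Sum.inr i)} := by
        simp only [ofPred_forall]
        exact isClosed_iInter fun i => isClosed_le continuous_const
          ((continuous_apply _).comp (hsolc D))
      exact h1.inter h2
    · intro t ht
      obtain ⟨D, hD, l, hl⟩ := hXD _ (hγV t ht)
      refine ⟨D, hD, ?_⟩
      rw [mem_ofPred_eq, hl.eq_kktSolution (hunit D hD), Sum.elim_comp_inl]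
      exact ⟨hl.feasible, fun i => hl.nonneg i i.2⟩
    · intro D hD t ht hmem
      refine (hXuniq _ (hγV t ht) _ (IsKKTPoint.mem_argminMap (D := D)
        (l := fun i => if h : i ∈ D then kktSolution Q A D (γ t) (Sum.inr ⟨i, h⟩) else 0)
        (isKKTPoint_kktSolution (hunit D hD) hmem.1 (fun i => by simp) fun i hi => ?_) hQ)).symm
      simpa [hi] using hmem.2 ⟨i, hi⟩
    · intro D hD r t hrt
      have h1 : kktSolution Q A D (γ t) ∘ Sum.inl - kktSolution Q A D (γ r) ∘ Sum.inl =
          (t - r) • (solutionMatrix Q A D *ᵥ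
            Sum.elim (-(y₂ - y₁).1) (fun i : D => (y₂ - y₁).2 i)) := by
        change (kktSolution Q A D (γ t) - kktSolution Q A D (γ r)) ∘ Sum.inl = _
        rw [kktSolution_sub, kktSolution, ← Matrix.mulVec_smul, solutionMatrix_mulVec]
        congr 2
        ext (i | i) <;> simp [hγ] <;> ring
      rw [h1, map_smul_eq_mul, Real.norm_of_nonneg (sub_nonneg.2 hrt), mul_comm]
      refine mul_le_mul_of_nonneg_right ?_ (sub_nonneg.2 hrt)
      refine (seminorm_mulVec_le hN _ _ _).trans ?_
      refine mul_le_mul (hκ D hD) ?_ (paramNorm_nonneg _) κ.coe_nonneg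
      refine max_le_max (by rw [dualNorm_neg]) ?_
      exact (pi_norm_le_iff_of_nonneg (norm_nonneg _)).2 fun i => norm_le_pi_norm (y₂ - y₁).2 i
  rw [hγ1, hγ0, ← hXuniq y₂ hy₂ x₂ hx₂] at hbound
  refine (iInf₂_le (X y₁) (hX y₁ hy₁)).trans ?_
  rw [← ENNReal.ofReal_coe_nnreal, ← ENNReal.ofReal_mul κ.coe_nonneg]
  exact ENNReal.ofReal_le_ofReal hbound

end UpperBound

theorem extendedKKTSets_nonempty {n m : ℕ} {Q : Matrix (Fin n) (Fin n) ℝ}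
    {A : Matrix (Fin m) (Fin n) ℝ} (hQ : Q.PosSemidef) {c : Fin n → ℝ} {b : Fin m → ℝ}
    {x : Fin n → ℝ} (hx : x ∈ argminMap Q A (c, b)) : (extendedKKTSets Q A c b x).Nonempty := by
  obtain ⟨D, -, hD, -⟩ := exists_isKKTPoint_pos hQ hx
  exact ⟨D, hD⟩

end ConvexQP

/-! ### The equivalence and the formula for the modulus -/

open ConvexQP in
theorem mainTheorem1 {n m : ℕ} (Q : Matrix (Fin n) (Fin n) ℝ) (hQ : Q.PosSemidef)
    (A : Matrix (Fin m) (Fin n) ℝ)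
    (N : Seminorm ℝ (Fin n → ℝ)) (hN : ∀ x, N x = 0 → x = 0)
    (c : Fin n → ℝ) (b : Fin m → ℝ) (x : Fin n → ℝ)
    (hSCQ : ConvexQP.SlaterCQ A b)
    (hS : ConvexQP.argminMap Q A (c, b) = {x}) :
    List.TFAE
      [ConvexQP.HasAubinProperty (ConvexQP.paramNorm N) N (ConvexQP.argminMap Q A) (c, b) x,
        ∀ D ∈ ConvexQP.minimalKKTSets Q A c b x, IsUnit (ConvexQP.kktMatrix Q A D),
        ∀ D ∈ ConvexQP.extendedKKTSets Q A c b x, IsUnit (ConvexQP.kktMatrix Q A D)] ∧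
    (ConvexQP.HasAubinProperty (ConvexQP.paramNorm N) N (ConvexQP.argminMap Q A) (c, b) x →
      IsGreatest
        ((fun D => ENNReal.ofReal (ConvexQP.opNorm N (ConvexQP.solutionMatrix Q A D))) ''
          ConvexQP.extendedKKTSets Q A c b x)
        (ConvexQP.lipModulus (ConvexQP.paramNorm N) N (ConvexQP.argminMap Q A) (c, b) x)) := by
  have hx : x ∈ argminMap Q A (c, b) := by rw [hS]; rfl
  have hLfin : (extendedKKTSets Q A c b x).Finite := Set.toFinite _
  have hLne := extendedKKTSets_nonempty hQ hx
  obtain ⟨D₀, hD₀, hmax⟩ := Set.exists_max_image _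
    (fun D => opNorm N (solutionMatrix Q A D)) hLfin hLne
  have h13 : HasAubinProperty (paramNorm N) N (argminMap Q A) (c, b) x →
      ∀ D ∈ extendedKKTSets Q A c b x, IsUnit (kktMatrix Q A D) := by
    rintro ⟨-, κ, hκ⟩ D hD
    exact isUnit_kktMatrix_of_isLipschitzConstAt hQ hN hκ hx.1 hD
  have hlip : (∀ D ∈ extendedKKTSets Q A c b x, IsUnit (kktMatrix Q A D)) →
      IsLipschitzConstAt (paramNorm N) N (argminMap Q A) (c, b) x
        (opNorm N (solutionMatrix Q A D₀)).toNNReal := fun h =>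
    isLipschitzConstAt_of_opNorm_le hQ hN hSCQ hS h fun D hD =>
      (hmax D hD).trans (Real.le_coe_toNNReal _)
  constructor
  · tfae_have 1 → 3 := h13
    tfae_have 3 → 2 := fun h D hD => h D (minimalKKTSets_subset_extendedKKTSets hD)
    -- Independence of the rows is part of membership in `𝓛`; the kernel condition passes from the
    -- minimal subset `D'` up to `D`.
    tfae_have 2 → 3 := by
      intro h D hD
      obtain ⟨D', hD', hmin⟩ := hD.1.exists_minimal
      exact (isUnit_kktMatrix_iff hQ).2 ⟨hD.2, fun u h1 h2 =>
        ((isUnit_kktMatrix_iff hQ).1 (h D' hmin)).2 u h1 fun i hi => h2 i (hD' hi)⟩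
    tfae_have 3 → 1 := fun h => ⟨hx, _, hlip h⟩
    tfae_finish
  · intro hA
    have hunit := h13 hA
    have hlower : ∀ D ∈ extendedKKTSets Q A c b x,
        ENNReal.ofReal (opNorm N (solutionMatrix Q A D)) ≤
          lipModulus (paramNorm N) N (argminMap Q A) (c, b) x := by
      refine fun D hD => le_iInf₂ fun κ hκ => ?_
      rw [← ENNReal.ofReal_coe_nnreal]
      exact ENNReal.ofReal_le_ofReal
        (opNorm_le_of_isLipschitzConstAt hQ hκ hx.1 hD.1 (hunit D hD))
    -- The largest operator norm is itself a Lipschitz constant, so the infimum is attained and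
    -- equals the value at `D₀`.
    refine ⟨⟨D₀, hD₀, le_antisymm (hlower D₀ hD₀) ?_⟩, ?_⟩
    · exact iInf₂_le _ (hlip hunit)
    · rintro _ ⟨D, hD, rfl⟩
      exact hlower D hD
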